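/- **Corollary (Hypertree width and fractional hypertree width do not have finite index).** *Hypergraphs.* All hypergraphs are finite; $E(H)$ is a multiset of subsets of $V(H)$. The primal graph of $H$ joins two distinct vertices that lie in a common hyperedge. A tree decomposition of a graph consists of a rooted tree and a bag (vertex set) for each node such that every vertex and every edge lies in a bag and the nodes whose bags contain a given vertex induce a nonempty subtree. After removing isolated vertices (vertices in no hyperedge), $H$ has *hypertree width at most $k$* if its primal graph has a tree decomposition in which each bag is covered by at most $k$ hyperedges, where a hyperedge $e$ may be used for the bag of a node $x$ only if this bag contains all vertices of $e$ that occur in bags of the subtree rooted at $x$. It has *fractional hypertree width at most $k$* if its primal graph has a tree decomposition such that for each bag there are nonnegative weights on the hyperedges, of total at most $k$, for which each vertex of the bag lies in hyperedges of total weight at least $1$. *Boundaried hypergraphs.* A $t$-boundaried hypergraph is a hypergraph with $t$ distinct vertices or hyperedges labelled $1,\dots,t$. Two of them are gluable if no label belongs to a vertex of one and to a hyperedge of the other; then $H_1\oplus H_2$ is their disjoint union with equally labelled vertices identified and equally labelled hyperedges replaced by their union. For sets $\mathcal F,\mathcal U$ of $t$-boundaried hypergraphs, write $G_1\sim_{\mathcal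 F}^{\mathcal U}G_2$ if $G_1,G_2$ are gluable and $G_1\oplus H\in\mathcal F\iff G_2\oplus H\in\mathcal F$ for all $H\in\mathcal U$ that are gluable to both. The canonical right congruence is $\sim_{\mathcal F}:=\sim_{\mathcal F}^{\mathcal U}$ for $\mathcal U$ the class of all $t$-boundaried hypergraphs. *Parse trees.* Consider graphs with vertices coloured $1$ or $2$ and $t$ distinct vertices labelled $1,\dots,t$. The size-$t$ parsing operators are: $\emptyset_{n_1,n_2}$ with $n_1+n_2=t$ (create $t$ isolated labelled vertices, the first $n_1$ of colour $1$, the others of colour $2$); $e$ (add an edge between the vertices labelled $1$ and $2$); $u_\ell$ for $\ell\in\{1,2\}$ (add a new vertex of colour $\ell$ that takes over the label $1$); $\gamma$ (move each label $j$ to the vertex with label $j+1$, cyclically); $i$ (exchange the labels $1$ and $2$); and the binary $\oplus_c$ (disjoint union with equally labelled vertices identified, defined if equally labelled vertices have the same colour). A graph is well-coloured if no two vertices of the same colour are adjacent; it then represents the $t$-boundaried hypergraph $\mathcal H(G)$ with the colour-$1$ vertices as vertices and one hyperedge $N(w)$ for each colour-$2$ vertex $w$, with inherited labels. The small universe $\mathcal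 H^{\mathrm{small}}_t$ is the set of all $\mathcal H(G)$ for well-coloured $G$ generated by the size-$t$ operators. *Statement.* Let $t\ge 41$, and let $\mathcal F$ be the set of $t$-boundaried hypergraphs of hypertree width at most $4$, or the set of $t$-boundaried hypergraphs of fractional hypertree width at most $4$. Then: 1. $\sim_{\mathcal F}$ has infinitely many equivalence classes on $\mathcal H^{\mathrm{small}}_t$, and so has $\sim_{\mathcal F}^{\mathcal U}$ for $\mathcal U=\mathcal H^{\mathrm{small}}_t$. 2. No deterministic leaf-to-root finite tree automaton recognizes the set of parse trees that generate well-coloured graphs $G$ with $\mathcal H(G)\in\mathcal F$. Moreover, no such automaton accepts, among the parse trees generating well-coloured graphs $G$, exactly those with $\mathcal H(G)\in\mathcal F$. -/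

import Mathlib

/-! ### Finite trees and deterministic leaf-to-root tree automata -/

/-- Rooted binary trees whose nodes (with zero, one or two children) are labelled by letters
of `S`. -/
inductive LTree (S : Type) : Type
  | leaf (a : S) : LTree S
  | unary (a : S) (x : LTree S) : LTree S
  | binary (a : S) (x y : LTree S) : LTree S

/-- A deterministic leaf-to-root finite-state tree automaton over the alphabet `S`. The
transition function on `(S × Q) ∪ (S × Q × Q)` is given by its two parts. -/
structure TreeAutomaton (S : Type) where
  State : Type
  finite_state : Finite State
  start : State
  final : Set State
  step₁ : S → State → State
  step₂ : S → State → State → State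

/-- The state that the automaton reaches at the root of a tree. -/
def TreeAutomaton.run {S : Type} (A : TreeAutomaton S) : LTree S → A.State
  | .leaf a => A.step₁ a A.start
  | .unary a x => A.step₁ a (A.run x)
  | .binary a x y => A.step₂ a (A.run x) (A.run y)

def TreeAutomaton.Accepts {S : Type} (A : TreeAutomaton S) (T : LTree S) : Prop :=
  A.run T ∈ A.final

def TreeAutomaton.Recognizes {S : Type} (A : TreeAutomaton S) (L : Set (LTree S)) : Prop :=
  ∀ T : LTree S, A.Accepts T ↔ T ∈ L

/-! ### Gluing two types along a partial matching -/

/-- The disjoint union of `α` and `β` in which `a : α` and `b : β` are identified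
whenever `M a b`. -/
def Glued {α β : Type} (M : α → β → Prop) : Type :=
  Quot (fun x y : α ⊕ β => ∃ a b, M a b ∧ x = Sum.inl a ∧ y = Sum.inr b)

def Glued.mk {α β : Type} (M : α → β → Prop) (x : α ⊕ β) : Glued M := Quot.mk _ x

theorem Glued.finite {α β : Type} (M : α → β → Prop) (hα : Finite α) (hβ : Finite β) :
    Finite (Glued M) :=
  Finite.of_surjective (Glued.mk M) Quot.mk_surjective

open Classical in
theorem Glued.mk_inl_injective {α β : Type} (M : α → β → Prop)
    (hM : ∀ a a' b, M a b → M a' b → a = a') :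
    Function.Injective (fun a : α => Glued.mk M (Sum.inl a)) := by
  let f : α ⊕ β → α ⊕ β := fun x =>
    Sum.elim Sum.inl
      (fun b => if h : ∃ a, M a b then Sum.inl (Classical.choose h) else Sum.inr b) x
  have hf : ∀ x y : α ⊕ β, (∃ a b, M a b ∧ x = Sum.inl a ∧ y = Sum.inr b) → f x = f y := by
    rintro _ _ ⟨a, b, hab, rfl, rfl⟩
    have h : ∃ a, M a b := ⟨a, hab⟩
    simp only [f, Sum.elim_inl, Sum.elim_inr, dif_pos h]
    rw [hM _ _ _ hab (Classical.choose_spec h)]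
  intro a a' h
  have h2 : Quot.lift f hf (Glued.mk M (Sum.inl a)) = Quot.lift f hf (Glued.mk M (Sum.inl a')) :=
    congrArg _ h
  exact Sum.inl_injective h2

/-! ### Two-coloured boundaried graphs -/

/-- Colour 1 marks the vertices of a hypergraph, colour 2 marks its hyperedges. -/
inductive Color : Type
  | vertex
  | hyperedge

/-- A finite graph with vertices coloured by two colours and with `t` distinct distinguished
vertices. The label `i + 1` of the mathematical text is `i : Fin t` here. -/
structure BdGraph (t : ℕ) where
  V : Type
  finite_V : Finite V
  graph : SimpleGraph V
  color : V → Color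
  lab : Fin t → V
  lab_injective : Function.Injective lab

namespace BdGraph

def Compatible {t : ℕ} (G₁ G₂ : BdGraph t) : Prop :=
  ∀ i, G₁.color (G₁.lab i) = G₂.color (G₂.lab i)

/-- The vertices to be identified: those with the same label. -/
def SameLabel {t : ℕ} (G₁ G₂ : BdGraph t) (v : G₁.V) (w : G₂.V) : Prop :=
  ∃ i, G₁.lab i = v ∧ G₂.lab i = w

/-- Gluing of two colour-compatible graphs: disjoint union with equally labelled vertices
identified. -/
def glue {t : ℕ} (G₁ G₂ : BdGraph t) (h : Compatible G₁ G₂) : BdGraph t where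
  V := Glued (SameLabel G₁ G₂)
  finite_V := Glued.finite _ G₁.finite_V G₂.finite_V
  graph := (G₁.graph ⊕g G₂.graph).map (Glued.mk (SameLabel G₁ G₂))
  color := Quot.lift (Sum.elim G₁.color G₂.color) (by
    rintro _ _ ⟨_, _, ⟨i, rfl, rfl⟩, rfl, rfl⟩
    exact h i)
  lab i := Glued.mk _ (Sum.inl (G₁.lab i))
  lab_injective := by
    refine (Glued.mk_inl_injective (SameLabel G₁ G₂) ?_).comp G₁.lab_injective
    rintro _ _ _ ⟨i, rfl, rfl⟩ ⟨j, rfl, hj⟩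
    rw [G₂.lab_injective hj]

/-- `t` isolated boundary vertices, the first `n` of colour 1 and the others of colour 2. -/
def isolated (t n : ℕ) : BdGraph t where
  V := Fin t
  finite_V := inferInstance
  graph := ⊥
  color i := if i.val < n then Color.vertex else Color.hyperedge
  lab := id
  lab_injective := Function.injective_id

/-- Add an edge between the boundary vertices with the first and the second label. -/
def addEdge {t : ℕ} [NeZero t] (G : BdGraph t) : BdGraph t :=
  { G with graph := G.graph ⊔ SimpleGraph.edge (G.lab 0) (G.lab 1) }

open Classical in
/-- Add a new vertex of colour `c`, which takes over the first label. -/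
def newVertex {t : ℕ} [NeZero t] (c : Color) (G : BdGraph t) : BdGraph t where
  V := Option G.V
  finite_V := by
    have := G.finite_V
    infer_instance
  graph := G.graph.map some
  color := fun v => v.elim c G.color
  lab i := if i = 0 then none else some (G.lab i)
  lab_injective := by
    intro i j hij
    by_cases hi : i = 0 <;> by_cases hj : j = 0 <;> simp [hi, hj] at hij ⊢
    exact G.lab_injective hij

/-- Move each label `j` to the vertex with label `j + 1` (cyclically). -/
def rotate {t : ℕ} [NeZero t] (G : BdGraph t) : BdGraph t :=
  { G with
    lab := fun j => G.lab (j + 1)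
    lab_injective := G.lab_injective.comp (add_left_injective 1) }

/-- Exchange the first two labels. -/
def swapLabels {t : ℕ} [NeZero t] (G : BdGraph t) : BdGraph t :=
  { G with
    lab := fun j => G.lab (Equiv.swap 0 1 j)
    lab_injective := G.lab_injective.comp (Equiv.injective _) }

/-- Each of the two colour classes is independent. -/
def WellColored {t : ℕ} (G : BdGraph t) : Prop :=
  ∀ v w, G.graph.Adj v w → G.color v ≠ G.color w

end BdGraph

/-! ### Parsing operators and parse trees -/

/-- The (finite) alphabet of size-`t` parsing operators for two colours. The letter `empty n`
stands for the nullary operator `∅_{n, t - n}`, where `n ≤ t`. -/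
inductive ParseOp (t : ℕ) : Type
  | empty (n : Fin (t + 1))
  | edge
  | new (c : Color)
  | rotate
  | swap
  | glue

/-- `Generates T G`: the labelled tree `T` is the parse tree of a (well-formed) expression
whose value is `G`. -/
inductive Generates {t : ℕ} [NeZero t] : LTree (ParseOp t) → BdGraph t → Prop
  | empty (n : Fin (t + 1)) : Generates (.leaf (.empty n)) (BdGraph.isolated t n.val)
  | edge {T : LTree (ParseOp t)} {G : BdGraph t} :
      Generates T G → Generates (.unary .edge T) G.addEdge
  | new (c : Color) {T : LTree (ParseOp t)} {G : BdGraph t} :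
      Generates T G → Generates (.unary (.new c) T) (G.newVertex c)
  | rotate {T : LTree (ParseOp t)} {G : BdGraph t} :
      Generates T G → Generates (.unary .rotate T) G.rotate
  | swap {T : LTree (ParseOp t)} {G : BdGraph t} :
      Generates T G → Generates (.unary .swap T) G.swapLabels
  | glue {T₁ T₂ : LTree (ParseOp t)} {G₁ G₂ : BdGraph t} (h : BdGraph.Compatible G₁ G₂) :
      Generates T₁ G₁ → Generates T₂ G₂ → Generates (.binary .glue T₁ T₂) (G₁.glue G₂ h)

/-! ### Hypergraphs and boundaried hypergraphs -/

/-- A finite hypergraph. The hyperedges form a multiset of vertex sets: they are indexed by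
`E`, and `inc e` is the set of vertices of `e`. -/
structure FinHypergraph where
  V : Type
  E : Type
  finite_V : Finite V
  finite_E : Finite E
  inc : E → Set V

/-- A hypergraph with `t` distinct distinguished boundary objects, each of which is a vertex
or a hyperedge. -/
structure BdHypergraph (t : ℕ) extends FinHypergraph where
  lab : Fin t → V ⊕ E
  lab_injective : Function.Injective lab

namespace BdHypergraph

/-- No label belongs to a vertex of one hypergraph and to a hyperedge of the other. -/
def Gluable {t : ℕ} (H₁ H₂ : BdHypergraph t) : Prop :=
  ∀ i, (H₁.lab i).isLeft = (H₂.lab i).isLeft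

def SameVertexLabel {t : ℕ} (H₁ H₂ : BdHypergraph t) (v : H₁.V) (w : H₂.V) : Prop :=
  ∃ i, H₁.lab i = Sum.inl v ∧ H₂.lab i = Sum.inl w

def SameEdgeLabel {t : ℕ} (H₁ H₂ : BdHypergraph t) (e : H₁.E) (f : H₂.E) : Prop :=
  ∃ i, H₁.lab i = Sum.inr e ∧ H₂.lab i = Sum.inr f

/-- Gluing: disjoint union, with equally labelled vertices identified and equally labelled
hyperedges replaced by their union. It is used for gluable hypergraphs only. -/
def glue {t : ℕ} (H₁ H₂ : BdHypergraph t) : BdHypergraph t where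
  V := Glued (SameVertexLabel H₁ H₂)
  E := Glued (SameEdgeLabel H₁ H₂)
  finite_V := Glued.finite _ H₁.finite_V H₂.finite_V
  finite_E := Glued.finite _ H₁.finite_E H₂.finite_E
  inc e :=
    {x | (∃ (f : H₁.E) (v : H₁.V), v ∈ H₁.inc f ∧
            Glued.mk _ (Sum.inl f) = e ∧ Glued.mk _ (Sum.inl v) = x) ∨
         (∃ (f : H₂.E) (v : H₂.V), v ∈ H₂.inc f ∧
            Glued.mk _ (Sum.inr f) = e ∧ Glued.mk _ (Sum.inr v) = x)}
  lab i := Sum.map (fun v => Glued.mk _ (Sum.inl v)) (fun e => Glued.mk _ (Sum.inl e)) (H₁.lab i)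
  lab_injective := by
    refine (Function.Injective.sumMap (Glued.mk_inl_injective _ ?_)
      (Glued.mk_inl_injective _ ?_)).comp H₁.lab_injective
    · rintro a a' b ⟨i, hi, hi'⟩ ⟨j, hj, hj'⟩
      have hij : i = j := H₂.lab_injective (hi'.trans hj'.symm)
      subst hij
      exact Sum.inl_injective (hi.symm.trans hj)
    · rintro a a' b ⟨i, hi, hi'⟩ ⟨j, hj, hj'⟩
      have hij : i = j := H₂.lab_injective (hi'.trans hj'.symm)
      subst hij
      exact Sum.inr_injective (hi.symm.trans hj)

/-- The canonical right congruence of `F`, where the hypergraphs that are glued on as tests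
range over `U`. For `U = Set.univ` these are all boundaried hypergraphs. -/
def rightCongruence {t : ℕ} (U F : Set (BdHypergraph t)) : Setoid (BdHypergraph t) where
  r G₁ G₂ := Gluable G₁ G₂ ∧
    ∀ H ∈ U, Gluable G₁ H → Gluable G₂ H → (G₁.glue H ∈ F ↔ G₂.glue H ∈ F)
  iseqv :=
    { refl := fun _ => ⟨fun _ => rfl, fun _ _ _ _ => Iff.rfl⟩
      symm := fun h => ⟨fun i => (h.1 i).symm, fun H hH h1 h2 => (h.2 H hH h2 h1).symm⟩
      trans := fun h k => ⟨fun i => (h.1 i).trans (k.1 i), fun H hH h1 h3 =>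
        (h.2 H hH h1 (fun i => (h.1 i).symm.trans (h1 i))).trans
          (k.2 H hH (fun i => (h.1 i).symm.trans (h1 i)) h3)⟩ }

end BdHypergraph

/-- The members of `S` lie in infinitely many equivalence classes of `r`. -/
def HasInfiniteIndexOver {α : Type*} (r : Setoid α) (S : Set α) : Prop :=
  ((fun x => (Quotient.mk r x)) '' S).Infinite

open Classical in
/-- The hypergraph that a well-coloured graph represents: its vertices are the vertices of
colour 1, and each vertex `w` of colour 2 contributes the hyperedge `N(w)`; labels are
inherited. -/
noncomputable def BdGraph.toHypergraph {t : ℕ} (G : BdGraph t) : BdHypergraph t where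
  V := {v : G.V // G.color v = Color.vertex}
  E := {w : G.V // G.color w = Color.hyperedge}
  finite_V := by
    have := G.finite_V
    infer_instance
  finite_E := by
    have := G.finite_V
    infer_instance
  inc w := {v | G.graph.Adj w.1 v.1}
  lab i :=
    if h : G.color (G.lab i) = Color.vertex then Sum.inl ⟨G.lab i, h⟩
    else Sum.inr ⟨G.lab i, by
      cases hc : G.color (G.lab i)
      · exact absurd hc h
      · rfl⟩
  lab_injective := by
    intro i j hij
    by_cases hi : G.color (G.lab i) = Color.vertex <;>
      by_cases hj : G.color (G.lab j) = Color.vertex <;>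
      simp [hi, hj] at hij
    · exact G.lab_injective hij
    · exact G.lab_injective hij

/-- The small universe: the boundaried hypergraphs represented by well-coloured graphs that
the size-`t` parsing operators generate. -/
def smallUniverse (t : ℕ) [NeZero t] : Set (BdHypergraph t) :=
  {H | ∃ (T : LTree (ParseOp t)) (G : BdGraph t),
    Generates T G ∧ G.WellColored ∧ H = G.toHypergraph}

/-- The parse trees that generate the well-coloured graphs representing hypergraphs in `F`. -/
def parseTrees {t : ℕ} [NeZero t] (F : Set (BdHypergraph t)) : Set (LTree (ParseOp t)) :=
  {T | ∃ G : BdGraph t, Generates T G ∧ G.WellColored ∧ G.toHypergraph ∈ F}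

/-- The automaton answers membership in `F` correctly on every parse tree of the incidence
graph of a hypergraph; nothing is required of it on other trees. -/
def TreeAutomaton.Decides {t : ℕ} [NeZero t] (A : TreeAutomaton (ParseOp t))
    (F : Set (BdHypergraph t)) : Prop :=
  ∀ (T : LTree (ParseOp t)) (G : BdGraph t), Generates T G → G.WellColored →
    (A.Accepts T ↔ G.toHypergraph ∈ F)

/-! ### Tree decompositions, hypertree width and fractional hypertree width -/

/-- A (rooted) tree decomposition of a graph. -/
structure TreeDecomposition {V : Type} (G : SimpleGraph V) where
  Node : Type
  finite_node : Finite Node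
  tree : SimpleGraph Node
  isTree : tree.IsTree
  root : Node
  bag : Node → Set V
  vertex_mem : ∀ v, ∃ x, v ∈ bag x
  edge_mem : ∀ u v, G.Adj u v → ∃ x, u ∈ bag x ∧ v ∈ bag x
  subtree : ∀ v, (tree.induce {x | v ∈ bag x}).Connected

/-- `D.Below x y`: the node `y` belongs to the subtree rooted at `x`, that is, `x` lies on the
path from the root to `y`. -/
def TreeDecomposition.Below {V : Type} {G : SimpleGraph V} (D : TreeDecomposition G)
    (x y : D.Node) : Prop :=
  ∃ p : D.tree.Walk D.root y, p.IsPath ∧ x ∈ p.support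

namespace FinHypergraph

/-- Remove all isolated vertices, that is, vertices that lie in no hyperedge. -/
def removeIsolated (H : FinHypergraph) : FinHypergraph where
  V := {v : H.V // ∃ e, v ∈ H.inc e}
  E := H.E
  finite_V := by
    have := H.finite_V
    infer_instance
  finite_E := H.finite_E
  inc e := {v | v.1 ∈ H.inc e}

/-- Two distinct vertices are adjacent if they are together in some hyperedge. -/
def primalGraph (H : FinHypergraph) : SimpleGraph H.V where
  Adj u v := u ≠ v ∧ ∃ e, u ∈ H.inc e ∧ v ∈ H.inc e
  symm := ⟨fun _ _ h => ⟨h.1.symm, h.2.imp fun _ he => ⟨he.2, he.1⟩⟩⟩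
  loopless := ⟨fun _ h => h.1 rfl⟩

/-- Each vertex of `B` lies in some hyperedge of `C`. -/
def IsCover (H : FinHypergraph) (B : Set H.V) (C : Finset H.E) : Prop :=
  ∀ v ∈ B, ∃ e ∈ C, v ∈ H.inc e

/-- The nonnegative weights `w` give each vertex of `B` total incident weight at least one. -/
def IsFractionalCover (H : FinHypergraph) (B : Set H.V) (w : H.E → ℝ) : Prop :=
  (∀ e, 0 ≤ w e) ∧ ∀ v ∈ B, 1 ≤ ∑ᶠ (e : H.E) (_ : v ∈ H.inc e), w e

/-- The hypertree width of `H` is at most `k`: after removal of isolated vertices, some rooted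
tree decomposition of the primal graph has covers of all bags with at most `k` hyperedges
each, where a hyperedge `e` is used for the bag of `x` only if this bag contains all vertices
of `e` that occur in bags of the subtree rooted at `x`. -/
def HypertreeWidthLE (H : FinHypergraph) (k : ℕ) : Prop :=
  ∃ (D : TreeDecomposition H.removeIsolated.primalGraph)
    (C : D.Node → Finset H.removeIsolated.E),
    ∀ x, H.removeIsolated.IsCover (D.bag x) (C x) ∧ (C x).card ≤ k ∧
      ∀ e ∈ C x, ∀ y, D.Below x y → ∀ v ∈ D.bag y, v ∈ H.removeIsolated.inc e → v ∈ D.bag x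

/-- The fractional hypertree width of `H` is at most `k`: after removal of isolated vertices,
some tree decomposition of the primal graph has fractional covers of all bags with total
weight at most `k` each. -/
def FractionalHypertreeWidthLE (H : FinHypergraph) (k : ℝ) : Prop :=
  ∃ D : TreeDecomposition H.removeIsolated.primalGraph,
    ∀ x, ∃ w : H.removeIsolated.E → ℝ,
      H.removeIsolated.IsFractionalCover (D.bag x) w ∧ ∑ᶠ e, w e ≤ k

end FinHypergraph

/-- The `t`-boundaried hypergraphs of hypertree width at most `k`. -/
def KHTW (t k : ℕ) : Set (BdHypergraph t) :=
  {H | H.toFinHypergraph.HypertreeWidthLE k}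

/-- The `t`-boundaried hypergraphs of fractional hypertree width at most `k`. -/
def KFHTW (t k : ℕ) : Set (BdHypergraph t) :=
  {H | H.toFinHypergraph.FractionalHypertreeWidthLE k}

/-! The separating family consists of pairs of long paths that a decomposition of width four must
traverse in lockstep. Each side `s` of `syncHypergraph N` has two parallel strands of vertices, and
its step `p` is a hyperedge with positions `p` and `p + 1` of both strands. All first positions,
four hubs and three keys form a clique of two-element hyperedges, and so do all last positions with
the same hubs and keys. A left step `p` contains the key `p mod 3`, a right step `p` the two other
keys; hence a left and a right step cover all keys exactly if their indices are congruent modulo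
three.

If both sides have equally many steps, a path of bags follows them simultaneously: the two steps
with the same index and two pairs of hubs cover a bag, and these four hyperedges lie inside it
(`syncHypergraph_hasHypertreeDecomposition`).

Conversely, let the fractional width be at most four. By the Helly property of subtrees some bag
contains the start clique and some bag the end clique. Every bag on the tree path between them
contains the hubs, the keys and a vertex of each of the four strands. Hubs and strand vertices are
eight vertices of which no hyperedge contains more than two, so a cover of weight four is tight.
Tightness leaves the keys to the steps and forces the strand vertices of the bag into one step per
side, with congruent indices (`exists_congruent_steps`). Neighbouring bags share a vertex of each
strand, so each index changes by at most one; two congruent indices that start out equal then remain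
equal, and the lengths agree (`eq_of_hasFractionalHypertreeDecomposition`).

Each side alone is generated by a parse tree (`constructible_side`): hubs, keys and the ends of the
strands keep their labels, and three further labels roll along the path. Gluing a left side of
parameter `a` to a right side of parameter `b` gives width at most four iff `a = b`. The left sides
are therefore pairwise inequivalent, and no finite set of states tells them all apart. -/

/-! ### Subtrees of a tree and their Helly property -/

namespace SimpleGraph

variable {V : Type*} {G : SimpleGraph V}

/-- Any two vertices of `A` are joined by a walk inside `A`. -/
def WalkConnected (G : SimpleGraph V) (A : Set V) : Prop :=
  ∀ a ∈ A, ∀ b ∈ A, ∃ p : G.Walk a b, ∀ x ∈ p.support, x ∈ A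

theorem walkConnected_of_induce_connected {A : Set V} (h : (G.induce A).Connected) :
    G.WalkConnected A := by
  intro a ha b hb
  obtain ⟨p⟩ := h.preconnected ⟨a, ha⟩ ⟨b, hb⟩
  refine ⟨p.map (Embedding.induce A).toHom, fun x hx => ?_⟩
  have hx : x ∈ (p.map (Embedding.induce A).toHom).support := hx
  rw [Walk.support_map, List.mem_map] at hx
  obtain ⟨y, -, rfl⟩ := hx
  exact y.2

theorem IsAcyclic.eq_bypass (hG : G.IsAcyclic) {a b : V} {p : G.Walk a b} (hp : p.IsPath)
    [DecidableEq V] (w : G.Walk a b) : p = w.bypass := by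
  have := (hG.subsingleton_path a b).elim ⟨p, hp⟩ w.toPath
  exact congrArg Subtype.val this

theorem IsAcyclic.support_subset (hG : G.IsAcyclic) {a b : V} {p : G.Walk a b} (hp : p.IsPath)
    (w : G.Walk a b) : p.support ⊆ w.support := by
  classical
  rw [hG.eq_bypass hp w]
  exact w.support_bypass_subset_support

theorem IsAcyclic.edges_subset (hG : G.IsAcyclic) {a b : V} {p : G.Walk a b} (hp : p.IsPath)
    (w : G.Walk a b) : p.edges ⊆ w.edges := by
  classical
  rw [hG.eq_bypass hp w]
  exact w.edges_bypass_subset_edges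

/-- A walk from `B` to `A`, each of whose edges lies in `A` or in `B`, meets `A ∩ B`. -/
theorem Walk.exists_mem_inter {A B : Set V} {a b : V} (p : G.Walk a b)
    (ha : a ∈ B) (hb : b ∈ A)
    (h : ∀ x y, s(x, y) ∈ p.edges → (x ∈ A ∧ y ∈ A) ∨ (x ∈ B ∧ y ∈ B)) :
    ∃ x ∈ p.support, x ∈ A ∧ x ∈ B := by
  induction p with
  | nil => exact ⟨_, by simp, hb, ha⟩
  | @cons u v w hadj q ih =>
    rcases h u v (by simp) with h1 | h1
    · exact ⟨u, by simp, h1.1, ha⟩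
    · obtain ⟨x, hx, hxx⟩ := ih h1.2 hb (fun x y hxy => h x y (by simp [hxy]))
      exact ⟨x, by simp [hx], hxx⟩

/-- The path between two vertices is unique and lies within every walk between them, in particular
within one inside `A`. -/
theorem IsAcyclic.path_support_subset (hG : G.IsAcyclic) {A : Set V} (hA : G.WalkConnected A)
    {a b : V} (ha : a ∈ A) (hb : b ∈ A) {p : G.Walk a b} (hp : p.IsPath) :
    ∀ x ∈ p.support, x ∈ A := by
  obtain ⟨w, hw⟩ := hA a ha b hb
  exact fun x hx => hw x (hG.support_subset hp w hx)

theorem IsAcyclic.walkConnected_inter (hG : G.IsAcyclic) {A B : Set V}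
    (hA : G.WalkConnected A) (hB : G.WalkConnected B) : G.WalkConnected (A ∩ B) := by
  classical
  intro a ha b hb
  obtain ⟨w, -⟩ := hA a ha.1 b hb.1
  exact ⟨w.bypass, fun x hx =>
    ⟨hG.path_support_subset hA ha.1 hb.1 w.bypass_isPath x hx,
      hG.path_support_subset hB ha.2 hb.2 w.bypass_isPath x hx⟩⟩

/-- Take `a ∈ B ∩ C`, `b ∈ A ∩ C` and `c ∈ A ∩ B`. The path from `a` to `b` stays in `C`, and its
edges are among those of a walk through `B` to `c` and on through `A` to `b`. It thus passes from
`B` to `A` at a common vertex. -/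
theorem IsAcyclic.inter_nonempty (hG : G.IsAcyclic) {A B C : Set V}
    (hA : G.WalkConnected A) (hB : G.WalkConnected B) (hC : G.WalkConnected C)
    (hAB : (A ∩ B).Nonempty) (hBC : (B ∩ C).Nonempty) (hAC : (A ∩ C).Nonempty) :
    ((A ∩ B) ∩ C).Nonempty := by
  classical
  obtain ⟨c, hcA, hcB⟩ := hAB
  obtain ⟨a, haB, haC⟩ := hBC
  obtain ⟨b, hbA, hbC⟩ := hAC
  obtain ⟨p, hp⟩ := hC a haC b hbC
  obtain ⟨q, hq⟩ := hB a haB c hcB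
  obtain ⟨r, hr⟩ := hA c hcA b hbA
  have hsub := hG.edges_subset p.bypass_isPath (q.append r)
  obtain ⟨x, hx, hxA, hxB⟩ := p.bypass.exists_mem_inter (A := A) (B := B) haB hbA (by
    intro x y hxy
    have := hsub hxy
    rw [Walk.edges_append, List.mem_append] at this
    rcases this with h | h
    · exact Or.inr ⟨hq _ (Walk.fst_mem_support_of_mem_edges _ h),
        hq _ (Walk.snd_mem_support_of_mem_edges _ h)⟩
    · exact Or.inl ⟨hr _ (Walk.fst_mem_support_of_mem_edges _ h),
        hr _ (Walk.snd_mem_support_of_mem_edges _ h)⟩)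
  exact ⟨x, ⟨hxA, hxB⟩, hp x (p.support_bypass_subset_support hx)⟩

/-- The Helly property of subtrees. -/
theorem IsAcyclic.helly (hG : G.IsAcyclic) [Nonempty V] {ι : Type*} (s : Finset ι) :
    ∀ (T : ι → Set V), (∀ i ∈ s, G.WalkConnected (T i)) →
      (∀ i ∈ s, ∀ j ∈ s, (T i ∩ T j).Nonempty) → ∃ x, ∀ i ∈ s, x ∈ T i := by
  classical
  induction s using Finset.induction_on with
  | empty => intro T _ _; exact ⟨Classical.arbitrary V, by simp⟩
  | insert k s hk ih =>
    intro T hT hTT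
    have hkk := Finset.mem_insert_self k s
    by_cases hs : s.Nonempty
    -- The intersections with `T k` are again subtrees, and they meet pairwise by the case of three
    -- subtrees.
    · obtain ⟨x, hx⟩ := ih (fun i => T i ∩ T k)
        (fun i hi => hG.walkConnected_inter (hT i (Finset.mem_insert_of_mem hi)) (hT k hkk))
        (fun i hi j hj => by
          have hi' := Finset.mem_insert_of_mem (b := k) hi
          have hj' := Finset.mem_insert_of_mem (b := k) hj
          obtain ⟨x, ⟨h1, h2⟩, h3⟩ := hG.inter_nonempty (hT i hi') (hT k hkk) (hT j hj')
            (hTT i hi' k hkk) (hTT k hkk j hj') (hTT i hi' j hj')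
          exact ⟨x, ⟨h1, h2⟩, h3, h2⟩)
      obtain ⟨i, hi⟩ := hs
      refine ⟨x, fun j hj => ?_⟩
      rcases Finset.mem_insert.1 hj with rfl | hj
      · exact (hx i hi).2
      · exact (hx j hj).1
    · rw [Finset.not_nonempty_iff_eq_empty] at hs
      subst hs
      obtain ⟨x, hx, -⟩ := hTT k hkk k hkk
      exact ⟨x, by simpa using hx⟩

/-- The largest vertex of a cycle would have two distinct neighbours on the cycle, but only its
predecessor is available. -/
theorem isTree_pathGraph (n : ℕ) : (pathGraph (n + 1)).IsTree := by
  refine ⟨pathGraph_connected n, ?_⟩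
  intro v c hc
  obtain ⟨m, hm, hmax⟩ := c.support.toFinset.exists_max_image id ⟨v, by simp⟩
  rw [List.mem_toFinset] at hm
  have hr := hc.rotate hm
  have hmem : ∀ x ∈ (c.rotate m hm).support, x ≤ m := fun x hx =>
    hmax x (by rw [List.mem_toFinset]; exact (Walk.mem_support_rotate_iff c m hm).1 hx)
  have h1 := (c.rotate m hm).adj_snd hr.not_nil
  have h2 := (c.rotate m hm).adj_penultimate hr.not_nil
  have h3 := hmem _ ((c.rotate m hm).getVert_mem_support 1)
  have h4 := hmem _ ((c.rotate m hm).getVert_mem_support ((c.rotate m hm).length - 1))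
  apply hr.snd_ne_penultimate
  change (c.rotate m hm).snd ≤ m at h3
  change (c.rotate m hm).penultimate ≤ m at h4
  rw [pathGraph_adj] at h1 h2
  rw [Fin.le_def] at h3 h4
  ext
  omega

end SimpleGraph

/-! ### Cliques and vertex sequences in tree decompositions -/

namespace TreeDecomposition

variable {V : Type} {G : SimpleGraph V} (D : TreeDecomposition G)

theorem walkConnected (v : V) : D.tree.WalkConnected {x | v ∈ D.bag x} :=
  SimpleGraph.walkConnected_of_induce_connected (D.subtree v)

/-- Each finite clique lies in a bag. -/
theorem exists_bag_of_clique (K : Finset V) (hK : ∀ u ∈ K, ∀ v ∈ K, u ≠ v → G.Adj u v) :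
    ∃ x, ∀ v ∈ K, v ∈ D.bag x := by
  have : Nonempty D.Node := ⟨D.root⟩
  refine D.isTree.isAcyclic.helly K (fun v => {x | v ∈ D.bag x})
    (fun v _ => D.walkConnected v) (fun u hu v hv => ?_)
  by_cases huv : u = v
  · subst huv
    obtain ⟨x, hx⟩ := D.vertex_mem u
    exact ⟨x, hx, hx⟩
  · exact D.edge_mem u v (hK u hu v hv huv)

/-- A sequence of vertices, with consecutive ones adjacent, yields a walk between bags of its
ends, along each edge of which some vertex of the sequence stays in the bag. -/
theorem exists_walk_of_sequence (f : ℕ → V) (n : ℕ) (hf : ∀ p < n, G.Adj (f p) (f (p + 1)))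
    {s e : D.Node} (hs : f 0 ∈ D.bag s) (he : f n ∈ D.bag e) :
    ∃ w : D.tree.Walk s e, (∀ x ∈ w.support, ∃ p ≤ n, f p ∈ D.bag x) ∧
      ∀ x y, s(x, y) ∈ w.edges → ∃ p ≤ n, f p ∈ D.bag x ∧ f p ∈ D.bag y := by
  induction n generalizing e with
  | zero =>
    obtain ⟨w, hw⟩ := D.walkConnected (f 0) s hs e he
    exact ⟨w, fun x hx => ⟨0, le_rfl, hw x hx⟩, fun x y hxy => ⟨0, le_rfl,
      hw _ (w.fst_mem_support_of_mem_edges hxy), hw _ (w.snd_mem_support_of_mem_edges hxy)⟩⟩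
  | succ n ih =>
    obtain ⟨z, hz1, hz2⟩ := D.edge_mem _ _ (hf n (Nat.lt_succ_self n))
    obtain ⟨w, hw1, hw2⟩ := ih (fun p hp => hf p (Nat.lt_succ_of_lt hp)) hz1
    obtain ⟨w', hw'⟩ := D.walkConnected (f (n + 1)) z hz2 e he
    refine ⟨w.append w', fun x hx => ?_, fun x y hxy => ?_⟩
    · rw [SimpleGraph.Walk.mem_support_append_iff] at hx
      rcases hx with hx | hx
      · obtain ⟨p, hp, h⟩ := hw1 x hx
        exact ⟨p, hp.trans (Nat.le_succ n), h⟩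
      · exact ⟨n + 1, le_rfl, hw' x hx⟩
    · rw [SimpleGraph.Walk.edges_append, List.mem_append] at hxy
      rcases hxy with hxy | hxy
      · obtain ⟨p, hp, h⟩ := hw2 x y hxy
        exact ⟨p, hp.trans (Nat.le_succ n), h⟩
      · exact ⟨n + 1, le_rfl, hw' _ (w'.fst_mem_support_of_mem_edges hxy),
          hw' _ (w'.snd_mem_support_of_mem_edges hxy)⟩

end TreeDecomposition

/-! ### The synchronised double path -/

/-- Vertices of the hypergraph `syncHypergraph N`: four hubs, three keys, and the vertices of
two doubled paths with `N s` steps. -/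
inductive SyncVertex (N : Bool → ℕ) : Type
  | hub (i : Fin 4)
  | key (c : Fin 3)
  | pos (s k : Bool) (p : Fin (N s + 1))

/-- Hyperedges of `syncHypergraph N`: pairs in two cliques, and the steps of the paths. -/
inductive SyncEdge (N : Bool → ℕ) : Type
  | pair (a b : SyncVertex N)
  | step (s : Bool) (p : Fin (N s))

namespace SyncVertex

variable {N : Bool → ℕ}

/-- The vertices of the clique at the starts of the paths. -/
def IsStart : SyncVertex N → Prop
  | hub _ => True
  | key _ => True
  | pos _ _ p => p.val = 0

/-- The vertices of the clique at the ends of the paths. -/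
def IsEnd : SyncVertex N → Prop
  | hub _ => True
  | key _ => True
  | pos s _ p => p.val = N s

def Joined (a b : SyncVertex N) : Prop :=
  a ≠ b ∧ ((a.IsStart ∧ b.IsStart) ∨ (a.IsEnd ∧ b.IsEnd))

/-- The steps of the left path (`s = false`) contain the key of their residue class, the steps
of the right path the two other keys. -/
def HasKey (s : Bool) (p : ℕ) (c : Fin 3) : Prop :=
  if s then p % 3 ≠ c.val else p % 3 = c.val

def InStep (s : Bool) (p : ℕ) : SyncVertex N → Prop
  | hub _ => False
  | key c => HasKey s p c
  | pos s' _ q => s' = s ∧ (q.val = p ∨ q.val = p + 1)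

theorem finite (N : Bool → ℕ) : Finite (SyncVertex N) := by
  let f : Fin 4 ⊕ Fin 3 ⊕ (Σ s : Bool, Bool × Fin (N s + 1)) → SyncVertex N :=
    Sum.elim hub (Sum.elim key (fun x => pos x.1 x.2.1 x.2.2))
  refine Finite.of_surjective f ?_
  rintro (i | c | ⟨s, k, p⟩)
  · exact ⟨Sum.inl i, rfl⟩
  · exact ⟨Sum.inr (Sum.inl c), rfl⟩
  · exact ⟨Sum.inr (Sum.inr ⟨s, k, p⟩), rfl⟩

end SyncVertex

theorem SyncEdge.finite (N : Bool → ℕ) : Finite (SyncEdge N) := by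
  have := SyncVertex.finite N
  let f : (SyncVertex N × SyncVertex N) ⊕ (Σ s : Bool, Fin (N s)) → SyncEdge N :=
    Sum.elim (fun x => .pair x.1 x.2) (fun x => .step x.1 x.2)
  refine Finite.of_surjective f ?_
  rintro (⟨a, b⟩ | ⟨s, p⟩)
  · exact ⟨Sum.inl (a, b), rfl⟩
  · exact ⟨Sum.inr ⟨s, p⟩, rfl⟩

/-- The vertices of a hyperedge. -/
def SyncEdge.verts {N : Bool → ℕ} : SyncEdge N → Set (SyncVertex N)
  | .pair a b => {v | a.Joined b ∧ (v = a ∨ v = b)}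
  | .step s p => {v | v.InStep s p.val}

/-- Two doubled paths between a start clique and an end clique, with steps that cover the keys
jointly exactly if they are congruent modulo three. -/
abbrev syncHypergraph (N : Bool → ℕ) : FinHypergraph where
  V := SyncVertex N
  E := SyncEdge N
  finite_V := SyncVertex.finite N
  finite_E := SyncEdge.finite N
  inc := SyncEdge.verts

/-! ### Transport of decompositions between hypergraphs with matching nonempty hyperedges -/

theorem finsum_mem_inc {V E : Type*} [Fintype E] (inc : E → Set V) (w : E → ℝ) (v : V)
    [DecidablePred fun e => v ∈ inc e] :
    ∑ᶠ (e : E) (_ : v ∈ inc e), w e = ∑ e, if v ∈ inc e then w e else 0 := by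
  rw [finsum_eq_sum_of_fintype]
  refine Finset.sum_congr rfl fun e _ => ?_
  by_cases h : v ∈ inc e <;> simp [h]

namespace FinHypergraph

/-- Hypertree width at most `k`, without removal of isolated vertices. -/
def HasHypertreeDecomposition (H : FinHypergraph) (k : ℕ) : Prop :=
  ∃ (D : TreeDecomposition H.primalGraph) (C : D.Node → Finset H.E),
    ∀ x, H.IsCover (D.bag x) (C x) ∧ (C x).card ≤ k ∧
      ∀ e ∈ C x, ∀ y, D.Below x y → ∀ v ∈ D.bag y, v ∈ H.inc e → v ∈ D.bag x

/-- Fractional hypertree width at most `k`, without removal of isolated vertices. -/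
def HasFractionalHypertreeDecomposition (H : FinHypergraph) (k : ℝ) : Prop :=
  ∃ D : TreeDecomposition H.primalGraph, ∀ x, ∃ w : H.E → ℝ,
    H.IsFractionalCover (D.bag x) w ∧ ∑ᶠ e, w e ≤ k

/-- A bijection between the vertices that maps the nonempty hyperedges of each hypergraph to
hyperedges of the other one. -/
def IsSimilarity (H K : FinHypergraph) (f : H.V ≃ K.V) : Prop :=
  (∀ e, (H.inc e).Nonempty → ∃ e', ∀ v, v ∈ H.inc e ↔ f v ∈ K.inc e') ∧
    ∀ e', (K.inc e').Nonempty → ∃ e, ∀ v, v ∈ H.inc e ↔ f v ∈ K.inc e'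

theorem IsSimilarity.symm {H K : FinHypergraph} {f : H.V ≃ K.V} (h : IsSimilarity H K f) :
    IsSimilarity K H f.symm := by
  refine ⟨fun e' he' => ?_, fun e he => ?_⟩
  · obtain ⟨e, he⟩ := h.2 e' he'
    exact ⟨e, fun v => by simpa using (he (f.symm v)).symm⟩
  · obtain ⟨e', he'⟩ := h.1 e he
    exact ⟨e', fun v => by simpa using (he' (f.symm v)).symm⟩

theorem IsSimilarity.adj {H K : FinHypergraph} {f : H.V ≃ K.V} (h : IsSimilarity H K f)
    {u v : K.V} (huv : K.primalGraph.Adj u v) : H.primalGraph.Adj (f.symm u) (f.symm v) := by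
  obtain ⟨hne, e', hu, hv⟩ := huv
  obtain ⟨e, he⟩ := h.2 e' ⟨u, hu⟩
  refine ⟨fun h => hne (f.symm.injective h), e, ?_, ?_⟩
  · rw [he]; simpa using hu
  · rw [he]; simpa using hv

/-- Transport of a tree decomposition along a similarity. -/
def IsSimilarity.mapDecomposition {H K : FinHypergraph} {f : H.V ≃ K.V}
    (h : IsSimilarity H K f) (D : TreeDecomposition H.primalGraph) :
    TreeDecomposition K.primalGraph where
  Node := D.Node
  finite_node := D.finite_node
  tree := D.tree
  isTree := D.isTree
  root := D.root
  bag x := {v | f.symm v ∈ D.bag x}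
  vertex_mem v := D.vertex_mem (f.symm v)
  edge_mem _ _ huv := D.edge_mem _ _ (h.adj huv)
  subtree v := D.subtree (f.symm v)

/-- Empty hyperedges cover nothing and are dropped from the covers; every other one is replaced by a
hyperedge with the same vertices under `f`. -/
theorem IsSimilarity.hasHypertreeDecomposition {H K : FinHypergraph} {f : H.V ≃ K.V}
    (h : IsSimilarity H K f) {k : ℕ} (hH : H.HasHypertreeDecomposition k) :
    K.HasHypertreeDecomposition k := by
  classical
  obtain ⟨D, C, hC⟩ := hH
  choose g hg using h.1
  refine ⟨h.mapDecomposition D, fun x =>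
    ((C x).filter fun e => (H.inc e).Nonempty).attach.image
      fun e => g e.1 (Finset.mem_filter (p := fun e => (H.inc e).Nonempty).1 e.2).2,
    fun x => ⟨?_, ?_, ?_⟩⟩
  · intro v hv
    obtain ⟨e, heC, hve⟩ := (hC x).1 (f.symm v) hv
    refine ⟨g e ⟨_, hve⟩, Finset.mem_image.2
      ⟨⟨e, Finset.mem_filter.2 ⟨heC, _, hve⟩⟩, Finset.mem_attach _ _, rfl⟩, ?_⟩
    simpa using (hg e ⟨_, hve⟩ (f.symm v)).1 hve
  · exact (Finset.card_image_le.trans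
      (Finset.card_attach.trans_le (Finset.card_filter_le _ _))).trans (hC x).2.1
  · intro e' he' y hxy v hv hve
    obtain ⟨⟨e, he⟩, -, rfl⟩ := Finset.mem_image.1 he'
    obtain ⟨heC, hne⟩ := Finset.mem_filter.1 he
    exact (hC x).2.2 e heC y hxy (f.symm v) hv ((hg e hne _).2 (by simpa using hve))

/-- The weights of nonempty hyperedges are pushed forward along `g`. Hyperedges with a common image
add their weights, and the weight of empty ones is lost, so the total does not grow. -/
theorem IsSimilarity.hasFractionalHypertreeDecomposition {H K : FinHypergraph} {f : H.V ≃ K.V}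
    (h : IsSimilarity H K f) {k : ℝ} (hH : H.HasFractionalHypertreeDecomposition k) :
    K.HasFractionalHypertreeDecomposition k := by
  classical
  obtain ⟨D, hD⟩ := hH
  choose g hg using h.1
  refine ⟨h.mapDecomposition D, fun x => ?_⟩
  obtain ⟨w, ⟨hw0, hw1⟩, hwk⟩ := hD x
  have := H.finite_E
  have := K.finite_E
  have := Fintype.ofFinite H.E
  have := Fintype.ofFinite K.E
  refine ⟨fun e' => ∑ e, if ∃ h : (H.inc e).Nonempty, g e h = e' then w e else 0,
    ⟨fun e' => Finset.sum_nonneg fun e _ => ?_, fun v hv => ?_⟩, ?_⟩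
  · split_ifs
    exacts [hw0 e, le_rfl]
  · refine (hw1 (f.symm v) hv).trans ?_
    rw [finsum_mem_inc, finsum_mem_inc]
    simp only [← Finset.sum_filter]
    rw [Finset.sum_comm' (t' := Finset.univ) (s' := fun e =>
      Finset.univ.filter fun e' => v ∈ K.inc e' ∧ ∃ h : (H.inc e).Nonempty, g e h = e')
      (by intro a b; simp)]
    rw [Finset.sum_filter]
    refine Finset.sum_le_sum fun e _ => ?_
    rw [Finset.sum_const, nsmul_eq_mul]
    split_ifs with hve
    · have : 0 < (Finset.univ.filter
          fun e' => v ∈ K.inc e' ∧ ∃ h : (H.inc e).Nonempty, g e h = e').card := by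
        refine Finset.card_pos.2 ⟨g e ⟨_, hve⟩, ?_⟩
        rw [Finset.mem_filter]
        exact ⟨Finset.mem_univ _, by simpa using (hg e ⟨_, hve⟩ (f.symm v)).1 hve, ⟨_, hve⟩, rfl⟩
      have h1 : (1 : ℝ) ≤ (Finset.univ.filter
          fun e' => v ∈ K.inc e' ∧ ∃ h : (H.inc e).Nonempty, g e h = e').card := by exact_mod_cast this
      nlinarith [hw0 e]
    · exact mul_nonneg (Nat.cast_nonneg _) (hw0 e)
  · rw [finsum_eq_sum_of_fintype] at hwk ⊢
    rw [Finset.sum_comm]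
    refine (Finset.sum_le_sum fun e _ => ?_).trans hwk
    by_cases hne : (H.inc e).Nonempty
    · simp [hne]
    · simp [hne, hw0 e]

theorem HasHypertreeDecomposition.fractional {H : FinHypergraph} {k : ℕ}
    (h : H.HasHypertreeDecomposition k) : H.HasFractionalHypertreeDecomposition k := by
  classical
  obtain ⟨D, C, hC⟩ := h
  have := H.finite_E
  have := Fintype.ofFinite H.E
  refine ⟨D, fun x => ⟨fun e => if e ∈ C x then 1 else 0, ⟨fun e => ?_, fun v hv => ?_⟩, ?_⟩⟩
  · beta_reduce
    split_ifs <;> norm_num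
  · obtain ⟨e, he, hve⟩ := (hC x).1 v hv
    rw [finsum_mem_inc]
    have := Finset.single_le_sum
      (f := fun e => if v ∈ H.inc e then (if e ∈ C x then (1 : ℝ) else 0) else 0)
      (s := Finset.univ) (fun e _ => by split_ifs <;> norm_num) (Finset.mem_univ e)
    simpa [he, hve] using this
  · rw [finsum_eq_sum_of_fintype, Finset.sum_boole]
    have := (hC x).2.1
    simpa using this

end FinHypergraph

/-! ### Upper bound: sides of equal length -/

open SyncVertex in
theorem syncHypergraph_pair_adj {N : Bool → ℕ} {a b : SyncVertex N} (h : a.Joined b) :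
    (syncHypergraph N).primalGraph.Adj a b :=
  ⟨h.1, .pair a b, ⟨h, Or.inl rfl⟩, ⟨h, Or.inr rfl⟩⟩

theorem SimpleGraph.connected_induce_of_pairwise {V : Type*} {G : SimpleGraph V} {A : Set V}
    (hne : A.Nonempty) (h : ∀ x ∈ A, ∀ y ∈ A, x ≠ y → G.Adj x y) : (G.induce A).Connected := by
  have : Nonempty A := hne.to_subtype
  refine ⟨fun x y => ?_⟩
  by_cases hxy : x = y
  · subst hxy
    exact Reachable.refl _
  · exact Adj.reachable (h x x.2 y y.2 fun h => hxy (Subtype.ext h))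

/-- The bags of the decomposition that follows both paths simultaneously. -/
def SyncVertex.InBag {N : Bool → ℕ} (x : ℕ) : SyncVertex N → Prop
  | .hub _ => True
  | .key _ => True
  | .pos _ _ q => q.val = x ∨ q.val = x + 1

theorem SyncVertex.InStep.inBag {N : Bool → ℕ} {s : Bool} {p : ℕ} {v : SyncVertex N}
    (h : v.InStep s p) : v.InBag p := by
  cases v with
  | hub => trivial
  | key => trivial
  | pos => exact h.2

def syncDecomposition (n : ℕ) :
    TreeDecomposition (syncHypergraph fun _ => n + 1).primalGraph where
  Node := Fin (n + 1)
  finite_node := inferInstance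
  tree := SimpleGraph.pathGraph (n + 1)
  isTree := SimpleGraph.isTree_pathGraph n
  root := 0
  bag x := {v | SyncVertex.InBag x.val v}
  vertex_mem v := by
    rcases v with i | c | ⟨s, k, p⟩
    · exact ⟨0, trivial⟩
    · exact ⟨0, trivial⟩
    · have hp := p.2
      by_cases h : p.val = 0
      · exact ⟨0, Or.inl h⟩
      · exact ⟨⟨p.val - 1, by omega⟩, Or.inr (by change p.val = p.val - 1 + 1; omega)⟩
  edge_mem u v huv := by
    obtain ⟨-, e, hu, hv⟩ := huv
    rcases e with ⟨a, b⟩ | ⟨s, p⟩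
    · obtain ⟨⟨-, hab⟩, hu⟩ := hu
      obtain ⟨-, hv⟩ := hv
      rcases hab with ⟨ha, hb⟩ | ⟨ha, hb⟩
      · have key : ∀ w : SyncVertex fun _ => n + 1, w.IsStart → w.InBag 0 := by
          rintro (i | c | ⟨s, k, p⟩) hw
          exacts [trivial, trivial, Or.inl hw]
        refine ⟨0, ?_, ?_⟩
        · rcases hu with rfl | rfl
          exacts [key _ ha, key _ hb]
        · rcases hv with rfl | rfl
          exacts [key _ ha, key _ hb]
      · have key : ∀ w : SyncVertex fun _ => n + 1, w.IsEnd → w.InBag n := by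
          rintro (i | c | ⟨s, k, p⟩) hw
          exacts [trivial, trivial, Or.inr hw]
        refine ⟨Fin.last n, ?_, ?_⟩
        · rcases hu with rfl | rfl
          exacts [key _ ha, key _ hb]
        · rcases hv with rfl | rfl
          exacts [key _ ha, key _ hb]
    · exact ⟨p, SyncVertex.InStep.inBag hu, SyncVertex.InStep.inBag hv⟩
  subtree v := by
    have huniv : ((SimpleGraph.pathGraph (n + 1)).induce Set.univ).Connected :=
      (SimpleGraph.Iso.connected_iff (SimpleGraph.induceUnivIso _)).2
        (SimpleGraph.pathGraph_connected n)
    rcases v with i | c | ⟨s, k, p⟩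
    · exact huniv
    · exact huniv
    · have hp := p.2
      -- Position `p` occurs only in the bags `p - 1` and `p`, as far as these exist.
      refine SimpleGraph.connected_induce_of_pairwise ?_ ?_
      · by_cases h : p.val = 0
        · exact ⟨0, Or.inl h⟩
        · exact ⟨⟨p.val - 1, by omega⟩, Or.inr (by change p.val = p.val - 1 + 1; omega)⟩
      · intro x hx y hy hxy
        have hx : p.val = x.val ∨ p.val = x.val + 1 := hx
        have hy : p.val = y.val ∨ p.val = y.val + 1 := hy
        have hxy : x.val ≠ y.val := fun h => hxy (Fin.ext h)
        rw [SimpleGraph.pathGraph_adj]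
        omega

open Classical in
/-- The cover of a bag of `syncDecomposition n`. -/
noncomputable def syncCover (n : ℕ) (x : Fin (n + 1)) : Finset (SyncEdge fun _ => n + 1) :=
  {.step false x, .step true x, .pair (.hub 0) (.hub 1), .pair (.hub 2) (.hub 3)}

theorem mem_syncCover {n : ℕ} {x : Fin (n + 1)} {e : SyncEdge fun _ => n + 1} :
    e ∈ syncCover n x ↔ e = .step false x ∨ e = .step true x ∨ e = .pair (.hub 0) (.hub 1) ∨
      e = .pair (.hub 2) (.hub 3) := by
  simp [syncCover]

theorem card_syncCover_le (n : ℕ) (x : Fin (n + 1)) : (syncCover n x).card ≤ 4 := by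
  classical
  rw [syncCover]
  exact Finset.card_le_four

/-- The two steps used for bag `x` have the same index, so one contains the key `x mod 3` and the
other the remaining keys. -/
theorem syncHypergraph_hasHypertreeDecomposition (n : ℕ) :
    (syncHypergraph fun _ => n + 1).HasHypertreeDecomposition 4 := by
  refine ⟨syncDecomposition n, syncCover n, fun (x : Fin (n + 1)) => ⟨?_, ?_, ?_⟩⟩
  · have hj : ∀ i j : Fin 4, i ≠ j →
        (SyncVertex.hub i : SyncVertex fun _ => n + 1).Joined (.hub j) := fun i j hij =>
      ⟨fun h => hij (SyncVertex.hub.inj h), Or.inl ⟨trivial, trivial⟩⟩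
    rintro (i | c | ⟨s, k, p⟩) hv
    · have hi : (i = 0 ∨ i = 1) ∨ (i = 2 ∨ i = 3) := by clear hv; revert i; decide
      rcases hi with hi | hi
      · exact ⟨.pair (.hub 0) (.hub 1), mem_syncCover.2 (by simp), hj 0 1 (by decide),
          hi.imp (congrArg _) (congrArg _)⟩
      · exact ⟨.pair (.hub 2) (.hub 3), mem_syncCover.2 (by simp), hj 2 3 (by decide),
          hi.imp (congrArg _) (congrArg _)⟩
    · by_cases hc : x.val % 3 = c.val
      · exact ⟨.step false x, mem_syncCover.2 (by simp), hc⟩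
      · exact ⟨.step true x, mem_syncCover.2 (by simp), hc⟩
    · exact ⟨.step s x, mem_syncCover.2 (by cases s <;> simp), rfl, hv⟩
  · exact card_syncCover_le n x
  -- Every hyperedge of the cover lies entirely in the bag, so the condition on descendants holds
  -- for any choice of root.
  · intro e he y _ v _ hve
    rcases mem_syncCover.1 he with rfl | rfl | rfl | rfl
    · exact SyncVertex.InStep.inBag hve
    · exact SyncVertex.InStep.inBag hve
    · rcases hve.2 with rfl | rfl <;> trivial
    · rcases hve.2 with rfl | rfl <;> trivial

/-! ### Lower bound: tight fractional covers force the sides to advance together -/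

open Classical in
/-- If no hyperedge contains more than two vertices of `S`, then a fractional cover of `S` of
total weight at most `|S| / 2` is tight on `S`. -/
theorem tight_of_card_inter_le_two {V E : Type*} [Fintype E] (inc : E → Set V)
    (S : Finset V) (w : E → ℝ) (hw : ∀ e, 0 ≤ w e)
    (hcov : ∀ v ∈ S, 1 ≤ ∑ e, if v ∈ inc e then w e else 0)
    (hsum : 2 * ∑ e, w e ≤ S.card) (hS : ∀ e, (S.filter fun v => v ∈ inc e).card ≤ 2) :
    (∀ e, 0 < w e → 2 ≤ (S.filter fun v => v ∈ inc e).card) ∧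
      ∀ v ∈ S, (∑ e, if v ∈ inc e then w e else 0) ≤ 1 := by
  -- Double counting: `|S|` is at most the total weight received by `S`, which is at most twice the
  -- total weight of the hyperedges, which is at most `|S|`. All the inequalities are equalities,
  -- termwise.
  have hcount : ∑ v ∈ S, ∑ e, (if v ∈ inc e then w e else 0) =
      ∑ e, ((S.filter fun v => v ∈ inc e).card : ℝ) * w e := by
    rw [Finset.sum_comm]
    refine Finset.sum_congr rfl fun e _ => ?_
    rw [← Finset.sum_filter, Finset.sum_const, nsmul_eq_mul]
  have hle : ∀ e, ((S.filter fun v => v ∈ inc e).card : ℝ) * w e ≤ 2 * w e := fun e =>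
    mul_le_mul_of_nonneg_right (by exact_mod_cast hS e) (hw e)
  have h1 : (S.card : ℝ) ≤ ∑ v ∈ S, ∑ e, (if v ∈ inc e then w e else 0) := by
    simpa using Finset.sum_le_sum hcov
  have h2 := Finset.sum_le_sum fun e (_ : e ∈ Finset.univ) => hle e
  rw [← Finset.mul_sum] at h2
  constructor
  · intro e he
    have h3 := (Finset.sum_eq_sum_iff_of_le fun e (_ : e ∈ Finset.univ) => hle e).1
      (by rw [← Finset.mul_sum]; linarith) e (Finset.mem_univ e)
    have h4 := mul_right_cancel₀ he.ne' h3
    exact_mod_cast h4.ge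
  · intro v hv
    have h3 := (Finset.sum_eq_sum_iff_of_le hcov).1 (by simp; linarith) v hv
    exact h3.ge

namespace SyncVertex

variable {N : Bool → ℕ}

/-- The hubs together with one vertex from each of the four paths. -/
def transversal (P : (s : Bool) → Bool → Fin (N s + 1)) : Fin 4 ⊕ Bool × Bool → SyncVertex N :=
  Sum.elim hub fun x => pos x.1 x.2 (P x.1 x.2)

theorem transversal_injective (P : (s : Bool) → Bool → Fin (N s + 1)) :
    Function.Injective (transversal P) := by
  rintro (i | ⟨s, k⟩) (j | ⟨s', k'⟩) h
  · exact congrArg _ (hub.inj h)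
  · cases h
  · cases h
  · cases h
    rfl

open Classical in
noncomputable def transversalSet (P : (s : Bool) → Bool → Fin (N s + 1)) :
    Finset (SyncVertex N) :=
  Finset.univ.image (transversal P)

theorem mem_transversalSet {P : (s : Bool) → Bool → Fin (N s + 1)} {v : SyncVertex N} :
    v ∈ transversalSet P ↔ (∃ i, v = hub i) ∨ ∃ s k, v = pos s k (P s k) := by
  simp [transversalSet, transversal, eq_comm]

theorem card_transversalSet (P : (s : Bool) → Bool → Fin (N s + 1)) :
    (transversalSet P).card = 8 := by
  classical
  rw [transversalSet, Finset.card_image_of_injective _ (transversal_injective P)]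
  rfl

end SyncVertex

section LowerBound

open SyncVertex

section Bag

variable {N : Bool → ℕ} {P : (s : Bool) → Bool → Fin (N s + 1)}

theorem transversalSet_inter_step {s : Bool} {p : Fin (N s)} {v : SyncVertex N}
    (hv : v ∈ transversalSet P) (h : v ∈ SyncEdge.verts (.step s p)) :
    ∃ k, v = pos s k (P s k) := by
  rcases mem_transversalSet.1 hv with ⟨i, rfl⟩ | ⟨s', k, rfl⟩
  · exact h.elim
  · obtain ⟨rfl, -⟩ := h
    exact ⟨k, rfl⟩

open Classical in
-- A step meets only the two strands of its own side, and the transversal has one vertex on each.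
theorem card_transversalSet_inter_le (e : SyncEdge N) :
    ((transversalSet P).filter fun v => v ∈ SyncEdge.verts e).card ≤ 2 := by
  rcases e with ⟨a, b⟩ | ⟨s, p⟩
  · refine (Finset.card_le_card (t := ({a, b} : Finset (SyncVertex N))) fun v hv => ?_).trans
      Finset.card_le_two
    simpa using (Finset.mem_filter.1 hv).2.2
  · refine (Finset.card_le_card (t := ({pos s false (P s false), pos s true (P s true)} :
      Finset (SyncVertex N))) fun v hv => ?_).trans Finset.card_le_two
    obtain ⟨hv, h⟩ := Finset.mem_filter.1 hv
    obtain ⟨k, rfl⟩ := transversalSet_inter_step hv h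
    cases k <;> simp

open Classical in
-- The only candidates are the chosen vertices of the two strands of side `s`, so both must lie in
-- the step. By tightness this applies to every step of positive weight.
theorem inStep_of_two_le_card {s : Bool} {p : Fin (N s)}
    (h : 2 ≤ ((transversalSet P).filter
      fun v => v ∈ SyncEdge.verts (.step s p)).card) (k : Bool) :
    (pos s k (P s k) : SyncVertex N).InStep s p := by
  by_contra hk
  have : ((transversalSet P).filter
      fun v => v ∈ SyncEdge.verts (.step s p)).card ≤ 1 := by
    refine (Finset.card_le_card (t := ({pos s (!k) (P s !k)} :
      Finset (SyncVertex N))) fun v hv => ?_).trans (Finset.card_singleton _).le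
    obtain ⟨hv, h⟩ := Finset.mem_filter.1 hv
    obtain ⟨k', rfl⟩ := transversalSet_inter_step hv h
    have : k' ≠ k := by
      rintro rfl
      exact hk h
    obtain rfl : k' = !k := by revert this; cases k <;> cases k' <;> simp
    simp
  omega

open Classical in
-- Keys are outside the transversal, so a pair with two vertices in it has no room for a key. In a
-- tight cover only steps can cover keys.
theorem key_notMem_pair_of_two_le_card {a b : SyncVertex N}
    (h : 2 ≤ ((transversalSet P).filter
      fun v => v ∈ SyncEdge.verts (.pair a b)).card) (c : Fin 3) :
    key c ∉ SyncEdge.verts (.pair a b) := by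
  rintro ⟨-, hc⟩
  have key_notMem : (key c : SyncVertex N) ∉ transversalSet P := by
    rw [mem_transversalSet]
    rintro (⟨i, h⟩ | ⟨s, k, h⟩) <;> cases h
  have : ((transversalSet P).filter
      fun v => v ∈ SyncEdge.verts (.pair a b)).card ≤ 1 := by
    rcases hc with rfl | rfl
    · refine (Finset.card_le_card (t := ({b} : Finset (SyncVertex N))) fun v hv => ?_).trans
        (Finset.card_singleton _).le
      obtain ⟨hv, -, rfl | rfl⟩ := Finset.mem_filter.1 hv
      · exact absurd hv key_notMem
      · simp
    · refine (Finset.card_le_card (t := ({a} : Finset (SyncVertex N))) fun v hv => ?_).trans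
        (Finset.card_singleton _).le
      obtain ⟨hv, -, rfl | rfl⟩ := Finset.mem_filter.1 hv
      · simp
      · exact absurd hv key_notMem
  omega

/-- The steps of the path `s` in the residue class `c`. -/
def SyncEdge.IsStep (s : Bool) (c : ℕ) : SyncEdge N → Prop
  | .pair _ _ => False
  | .step s' p => s' = s ∧ p.val % 3 = c

/-- A bag with the hubs, the keys and a vertex of each path, if it is fractionally covered with
total weight four, contains vertices of one step of each path only, and these two steps are
congruent modulo three. -/
theorem exists_congruent_steps {B : Set (SyncVertex N)} {w : SyncEdge N → ℝ}
    (hw : (syncHypergraph N).IsFractionalCover B w) (hsum : ∑ᶠ e, w e ≤ 4)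
    (hhub : ∀ i, hub i ∈ B) (hkey : ∀ c, key c ∈ B) (hP : ∀ s k, pos s k (P s k) ∈ B) :
    ∃ r : Bool → ℕ, r false % 3 = r true % 3 ∧ ∀ s, r s < N s ∧
      ∀ k (q : Fin (N s + 1)), pos s k q ∈ B → q.val = r s ∨ q.val = r s + 1 := by
  classical
  have := SyncEdge.finite N
  have := Fintype.ofFinite (SyncEdge N)
  rw [finsum_eq_sum_of_fintype] at hsum
  obtain ⟨hw0, hw1⟩ := hw
  have hcov : ∀ v ∈ B, 1 ≤ ∑ e, if v ∈ SyncEdge.verts e then w e else 0 := by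
    intro v hv
    have := hw1 v hv
    rwa [finsum_mem_inc] at this
  -- Stated for every transversal within the bag, since one vertex of `P` is exchanged at the end.
  -- The eight vertices make total weight four tight.
  have htight : ∀ P : (s : Bool) → Bool → Fin (N s + 1), (∀ s k, pos s k (P s k) ∈ B) →
      (∀ e, 0 < w e →
        2 ≤ ((transversalSet P).filter fun v => v ∈ SyncEdge.verts e).card) ∧
      ∀ v ∈ transversalSet P,
        (∑ e, if v ∈ SyncEdge.verts e then w e else 0) ≤ 1 := by
    intro P hP
    refine tight_of_card_inter_le_two SyncEdge.verts (transversalSet P) w hw0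
      (fun v hv => hcov v ?_) ?_ card_transversalSet_inter_le
    · rcases mem_transversalSet.1 hv with ⟨i, rfl⟩ | ⟨s, k, rfl⟩
      exacts [hhub i, hP s k]
    · rw [card_transversalSet]
      push_cast
      linarith
  obtain ⟨hpos, hone⟩ := htight P hP
  -- `A s c` is the total weight of the steps of side `s` in residue class `c`.
  let A : Bool → ℕ → ℝ := fun s c => ∑ e : SyncEdge N,
    if SyncEdge.IsStep s c e then w e else 0
  -- Each step of side `s` with positive weight contains the chosen vertex of the strand `false`,
  -- whose received weight is at most one by tightness.
  have hA : ∀ s, A s 0 + A s 1 + A s 2 ≤ 1 := by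
    intro s
    refine le_trans ?_ (hone (pos s false (P s false)) (mem_transversalSet.2 (by simp)))
    simp only [A]
    rw [← Finset.sum_add_distrib, ← Finset.sum_add_distrib]
    refine Finset.sum_le_sum fun e _ => ?_
    rcases (hw0 e).eq_or_lt with he | he
    · simp [← he]
    · rcases e with ⟨a, b⟩ | ⟨s', p⟩
      · simp only [SyncEdge.IsStep, ↓reduceIte, add_zero]
        split_ifs
        exacts [hw0 _, le_rfl]
      · by_cases hs : s' = s
        · subst hs
          have hmem : pos s' false (P s' false) ∈ SyncEdge.verts (.step s' p) :=
            inStep_of_two_le_card (hpos _ he) false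
          rw [if_pos hmem]
          simp only [SyncEdge.IsStep, true_and]
          have : p.val % 3 = 0 ∨ p.val % 3 = 1 ∨ p.val % 3 = 2 := by omega
          rcases this with h | h | h <;> simp [h]
        · simp only [SyncEdge.IsStep, hs, false_and, if_false, add_zero]
          split_ifs
          exacts [hw0 _, le_rfl]
  -- Key `c` is covered by the left steps of class `c` and the right steps of the other two classes
  -- only.
  have hK : ∀ c : Fin 3,
      1 ≤ A false c.val + (A true 0 + A true 1 + A true 2) - A true c.val := by
    intro c
    refine (hcov _ (hkey c)).trans ?_
    simp only [A]
    rw [← Finset.sum_add_distrib, ← Finset.sum_add_distrib, ← Finset.sum_add_distrib,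
      ← Finset.sum_sub_distrib]
    refine Finset.sum_le_sum fun e _ => ?_
    rcases (hw0 e).eq_or_lt with he | he
    · simp [← he]
    · rcases e with ⟨a, b⟩ | ⟨s, p⟩
      · rw [if_neg (key_notMem_pair_of_two_le_card (hpos _ he) c)]
        simp [SyncEdge.IsStep]
      · have hmem : key c ∈ SyncEdge.verts (.step s p) ↔ HasKey s p c := Iff.rfl
        simp only [hmem]
        cases s
        · simp [SyncEdge.IsStep, HasKey]
        · have hp : p.val % 3 = 0 ∨ p.val % 3 = 1 ∨ p.val % 3 = 2 := by omega
          have hc := c.2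
          by_cases hpc : p.val % 3 = c.val
          · rcases hp with h | h | h <;> simp [SyncEdge.IsStep, HasKey, ← hpc, h]
          · rcases hp with h | h | h <;> rw [h] at hpc <;>
              simp [SyncEdge.IsStep, HasKey, h, hpc]
  have h0 := hK 0
  have h1 := hK 1
  have h2 := hK 2
  simp only [Fin.val_zero, Fin.val_one, Fin.val_two] at h0 h1 h2
  have hf := hA false
  have ht := hA true
  have hstep : ∀ s c, 0 < A s c → ∃ p : Fin (N s), p.val % 3 = c ∧ 0 < w (.step s p) := by
    intro s c h
    obtain ⟨e, -, he⟩ := Finset.exists_lt_of_sum_lt (s := Finset.univ)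
      (f := fun _ : SyncEdge N => (0 : ℝ))
      (g := fun e => if SyncEdge.IsStep s c e then w e else 0) (by simpa using h)
    split_ifs at he with hs
    · rcases e with ⟨a, b⟩ | ⟨s', p⟩
      · exact hs.elim
      · obtain ⟨rfl, hc⟩ := hs
        exact ⟨p, hc, he⟩
    · exact absurd he (lt_irrefl _)
  -- Adding the three key inequalities shows that the steps of each side have total weight one. Then
  -- `A false c ≥ A true c` for each `c` with equal sums, so both agree, and they are positive for
  -- some class.
  obtain ⟨c, hc⟩ : ∃ c, ∀ s, 0 < A s c := by
    by_contra! hcon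
    have hcon' : ∀ c : ℕ, A false c = A true c → A false c ≤ 0 := by
      intro c hc
      obtain ⟨s, hs⟩ := hcon c
      cases s <;> linarith
    have e0 := hcon' 0 (by linarith)
    have e1 := hcon' 1 (by linarith)
    have e2 := hcon' 2 (by linarith)
    linarith
  choose r hr using fun s => hstep s c (hc s)
  refine ⟨fun s => (r s).val, (hr false).1.trans (hr true).1.symm, fun s => ⟨(r s).2, ?_⟩⟩
  intro k q hq
  -- With `pos s k q` exchanged into the transversal the cover is still tight, so the step `r s`, of
  -- positive weight, contains this vertex as well.
  have hP' : ∀ s' k', pos s' k'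
      ((Function.update P s (Function.update (P s) k q)) s' k') ∈ B := by
    intro s' k'
    by_cases hs : s' = s
    · subst hs
      by_cases hk : k' = k
      · subst hk
        simpa using hq
      · simpa [hk] using hP s' k'
    · simpa [hs] using hP s' k'
  have := inStep_of_two_le_card ((htight _ hP').1 _ (hr s).2) k
  simpa [InStep] using this

end Bag

theorem pos_adj_succ {N : Bool → ℕ} (s k : Bool) {p : ℕ} (hp : p < N s) :
    (syncHypergraph N).primalGraph.Adj (pos s k ⟨p, by omega⟩) (pos s k ⟨p + 1, by omega⟩) := by
  refine ⟨fun h => ?_, .step s ⟨p, hp⟩, ⟨rfl, Or.inl rfl⟩, ⟨rfl, Or.inr rfl⟩⟩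
  simp at h

/-- The fractional hypertree width of the double path exceeds four if its paths differ in
length. -/
theorem eq_of_hasFractionalHypertreeDecomposition {N : Bool → ℕ}
    (h : (syncHypergraph N).HasFractionalHypertreeDecomposition 4) : N false = N true := by
  classical
  obtain ⟨D, hD⟩ := h
  have := SyncVertex.finite N
  have := Fintype.ofFinite (SyncVertex N)
  obtain ⟨a, ha⟩ := D.exists_bag_of_clique
    (Finset.univ.filter fun v : SyncVertex N => v.IsStart) fun u hu v hv huv =>
      syncHypergraph_pair_adj ⟨huv, Or.inl ⟨(Finset.mem_filter.1 hu).2, (Finset.mem_filter.1 hv).2⟩⟩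
  obtain ⟨b, hb⟩ := D.exists_bag_of_clique
    (Finset.univ.filter fun v : SyncVertex N => v.IsEnd) fun u hu v hv huv =>
      syncHypergraph_pair_adj ⟨huv, Or.inr ⟨(Finset.mem_filter.1 hu).2, (Finset.mem_filter.1 hv).2⟩⟩
  replace ha : ∀ v : SyncVertex N, v.IsStart → v ∈ D.bag a := fun v hv => ha v (by simpa using hv)
  replace hb : ∀ v : SyncVertex N, v.IsEnd → v ∈ D.bag b := fun v hv => hb v (by simpa using hv)
  obtain ⟨p, hp⟩ := (D.isTree.connected.preconnected a b).exists_isPath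
  have hac := D.isTree.isAcyclic
  -- Hubs and keys belong to both cliques, hence to all bags between `a` and `b`.
  have hconst : ∀ v : SyncVertex N, v.IsStart → v.IsEnd → ∀ x ∈ p.support, v ∈ D.bag x :=
    fun v h1 h2 => hac.path_support_subset (D.walkConnected v) (ha v h1) (hb v h2) hp
  -- Following a strand gives a walk from `a` to `b`, and such a walk contains all nodes and edges
  -- of the path `p`.
  have hpath : ∀ s k, (∀ x ∈ p.support, ∃ q, pos s k q ∈ D.bag x) ∧
      ∀ x y, s(x, y) ∈ p.edges → ∃ q, pos s k q ∈ D.bag x ∧ pos s k q ∈ D.bag y := by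
    intro s k
    obtain ⟨w, hw1, hw2⟩ := D.exists_walk_of_sequence
      -- The minimum only extends the strand to a sequence on all of `ℕ`.
      (fun q => pos s k ⟨min q (N s), by omega⟩) (N s) (fun q hq => by
        have := pos_adj_succ s k hq
        have h1 : min q (N s) = q := by omega
        have h2 : min (q + 1) (N s) = q + 1 := by omega
        simpa only [h1, h2] using this)
      (s := a) (e := b) (ha _ (Nat.zero_min _)) (hb _ (min_self _))
    refine ⟨fun x hx => ?_, fun x y hxy => ?_⟩
    · obtain ⟨q, -, hq⟩ := hw1 x (hac.support_subset hp w hx)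
      exact ⟨_, hq⟩
    · obtain ⟨q, -, hq⟩ := hw2 x y (hac.edges_subset hp w hxy)
      exact ⟨_, hq⟩
  have hsteps : ∀ x ∈ p.support, ∃ r : Bool → ℕ, r false % 3 = r true % 3 ∧ ∀ s, r s < N s ∧
      ∀ k (q : Fin (N s + 1)), pos s k q ∈ D.bag x → q.val = r s ∨ q.val = r s + 1 := by
    intro x hx
    obtain ⟨w, hw, hw4⟩ := hD x
    choose P hP using fun s k => (hpath s k).1 x hx
    exact exists_congruent_steps hw hw4 (fun i => hconst (hub i) trivial trivial x hx)
      (fun c => hconst (key c) trivial trivial x hx) hP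
  choose! r hr using hsteps
  have hedge : ∀ x y, s(x, y) ∈ p.edges → ∀ s, r x s ≤ r y s + 1 ∧ r y s ≤ r x s + 1 := by
    intro x y hxy s
    obtain ⟨q, hqx, hqy⟩ := (hpath s false).2 x y hxy
    have h1 := ((hr x (p.fst_mem_support_of_mem_edges hxy)).2 s).2 _ _ hqx
    have h2 := ((hr y (p.snd_mem_support_of_mem_edges hxy)).2 s).2 _ _ hqy
    omega
  -- Along an edge the difference of the two indices changes by at most two, and it is always a
  -- multiple of three; once zero it stays zero.
  have hinv : ∀ {x y} (q : D.tree.Walk x y), (∀ z ∈ q.support, r z false % 3 = r z true % 3) →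
      (∀ z z', s(z, z') ∈ q.edges → ∀ s, r z s ≤ r z' s + 1 ∧ r z' s ≤ r z s + 1) →
      r x false = r x true → r y false = r y true := by
    intro x y q
    induction q with
    | nil => exact fun _ _ h => h
    | @cons x z y hxz q ih =>
      intro h1 h2 h3
      refine ih (fun z hz => h1 z (by simp [hz])) (fun z z' hz => h2 z z' (by simp [hz])) ?_
      have e1 := h2 x z (by simp) false
      have e2 := h2 x z (by simp) true
      have e3 := h1 z (by simp)
      omega
  -- Bag `a` contains the first positions, which lie in step `0` only; likewise bag `b` contains the
  -- last ones, which lie in step `N s - 1` only.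
  have hstart : ∀ s, r a s = 0 := fun s => by
    have := ((hr a p.start_mem_support).2 s).2 false 0 (ha _ rfl)
    rw [Fin.val_zero] at this
    omega
  have hend : ∀ s, N s = r b s + 1 := fun s => by
    have h1 := (hr b p.end_mem_support).2 s
    have := h1.2 false (Fin.last _) (hb _ rfl)
    simp only [Fin.val_last] at this
    omega
  have := hinv p (fun z hz => (hr z hz).1) hedge (by rw [hstart, hstart])
  rw [hend, hend, this]

end LowerBound

/-! ### Graphs with named vertices that parse trees generate -/

/-- The vertices of `G` can be named by the elements of `S` in such a way that the colours are
given by `col`, the adjacency by `R` and the labelled vertices by `lam`. -/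
def BdGraph.IsNamed {t : ℕ} {α : Type} (col : α → Color) (R : α → α → Prop) (S : Set α)
    (lam : Fin t → α) (G : BdGraph t) : Prop :=
  ∃ ν : G.V → α, Function.Injective ν ∧ Set.range ν = S ∧ (∀ v, G.color v = col (ν v)) ∧
    (∀ v w, G.graph.Adj v w ↔ R (ν v) (ν w)) ∧ ∀ i, ν (G.lab i) = lam i

/-- Some parse tree generates a graph with the given names. -/
def Constructible {t : ℕ} [NeZero t] {α : Type} (col : α → Color) (R : α → α → Prop) (S : Set α)
    (lam : Fin t → α) : Prop :=
  ∃ (T : LTree (ParseOp t)) (G : BdGraph t), Generates T G ∧ G.IsNamed col R S lam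

namespace Constructible

variable {t : ℕ} [NeZero t] {α : Type} {col : α → Color} {R R' : α → α → Prop} {S : Set α}
  {lam : Fin t → α}

theorem congr (h : Constructible col R S lam) (hR : ∀ a ∈ S, ∀ b ∈ S, R a b ↔ R' a b) :
    Constructible col R' S lam := by
  obtain ⟨T, G, hG, ν, hinj, hran, hcol, hadj, hlab⟩ := h
  refine ⟨T, G, hG, ν, hinj, hran, hcol, fun v w => ?_, hlab⟩
  rw [hadj]
  exact hR _ (hran ▸ Set.mem_range_self v) _ (hran ▸ Set.mem_range_self w)

theorem isolated (n : ℕ) (hn : n ≤ t) (hlam : Function.Injective lam)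
    (hcol : ∀ i, col (lam i) = if i.val < n then Color.vertex else Color.hyperedge) :
    Constructible col (fun _ _ => False) (Set.range lam) lam :=
  ⟨_, _, Generates.empty ⟨n, Nat.lt_succ_of_le hn⟩, lam, hlam, rfl, fun i => (hcol i).symm,
    fun _ _ => Iff.rfl, fun _ => rfl⟩

theorem rotate (h : Constructible col R S lam) :
    Constructible col R S fun j => lam (j + 1) := by
  obtain ⟨T, G, hG, ν, hinj, hran, hcol, hadj, hlab⟩ := h
  exact ⟨_, _, hG.rotate, ν, hinj, hran, hcol, hadj, fun i => hlab (i + 1)⟩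

theorem swapLabels (h : Constructible col R S lam) :
    Constructible col R S (lam ∘ Equiv.swap 0 1) := by
  obtain ⟨T, G, hG, ν, hinj, hran, hcol, hadj, hlab⟩ := h
  exact ⟨_, _, hG.swap, ν, hinj, hran, hcol, hadj, fun i => hlab _⟩

/-- The cyclic rotation and one transposition of adjacent labels generate the symmetric group. -/
theorem comp_perm (ht : 2 ≤ t) (h : Constructible col R S lam) (π : Equiv.Perm (Fin t)) :
    Constructible col R S (lam ∘ π) := by
  obtain ⟨m, rfl⟩ : ∃ m, t = m + 2 := ⟨t - 2, by omega⟩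
  let K : Submonoid (Equiv.Perm (Fin (m + 2))) :=
    { carrier := {π | ∀ lam, Constructible col R S lam → Constructible col R S (lam ∘ π)}
      one_mem' := fun _ h => h
      mul_mem' := fun {a b} ha hb lam h => hb _ (ha _ h) }
  have hrot : finRotate (m + 2) ∈ K := fun lam h => by
    have := h.rotate
    convert! this using 2 with j
    simp
  have hswap : Equiv.swap (0 : Fin (m + 2)) 1 ∈ K := fun lam h => h.swapLabels
  have htop := Equiv.Perm.closure_cycle_adjacent_swap (σ := finRotate (m + 2))
    isCycle_finRotate support_finRotate 0
  have hπ : π ∈ Subgroup.closure {finRotate (m + 2), Equiv.swap 0 (finRotate (m + 2) 0)} :=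
    htop ▸ Subgroup.mem_top π
  -- In a finite group the generated submonoid is already the subgroup, so inverses of the operators
  -- are not needed.
  rw [← Subgroup.mem_toSubmonoid, Subgroup.closure_toSubmonoid_of_finite] at hπ
  have hle : Submonoid.closure {finRotate (m + 2), Equiv.swap 0 (finRotate (m + 2) 0)} ≤ K := by
    rw [Submonoid.closure_le]
    rintro _ (rfl | rfl)
    · exact hrot
    · simpa using hswap
  exact hle hπ lam h

/-- The labels `i` and `j` are moved to the first two places and, once the edge is there, moved
back. -/
theorem addEdge (ht : 2 ≤ t) (h : Constructible col R S lam) {i j : Fin t} (hij : i ≠ j) :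
    Constructible col
      (fun a b => R a b ∨ (a = lam i ∧ b = lam j) ∨ (a = lam j ∧ b = lam i)) S lam := by
  have h01 : (0 : Fin t) ≠ 1 := by
    obtain ⟨m, rfl⟩ : ∃ m, t = m + 2 := ⟨t - 2, by omega⟩
    exact zero_ne_one
  obtain ⟨π, h0, h1⟩ : ∃ π : Equiv.Perm (Fin t), π 0 = i ∧ π 1 = j := by
    refine ⟨(Equiv.swap (Equiv.swap 0 i 1) j : Equiv.Perm (Fin t)) * Equiv.swap 0 i, ?_, ?_⟩
    · rw [Equiv.Perm.mul_apply, Equiv.swap_apply_left]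
      refine Equiv.swap_apply_of_ne_of_ne (fun h => h01 ?_) hij
      rw [← Equiv.swap_apply_left (0 : Fin t) i] at h
      exact (Equiv.swap (0 : Fin t) i).injective (by simpa using h)
    · rw [Equiv.Perm.mul_apply, Equiv.swap_apply_left]
  obtain ⟨T, G, hG, ν, hinj, hran, hcol, hadj, hlab⟩ := h.comp_perm ht π
  have key : Constructible col
      (fun a b => R a b ∨ (a = lam i ∧ b = lam j) ∨ (a = lam j ∧ b = lam i)) S (lam ∘ π) := by
    refine ⟨_, _, hG.edge, ν, hinj, hran, hcol, fun (v w : G.V) => ?_, hlab⟩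
    have e0 : ν (G.lab 0) = lam i := by rw [hlab, Function.comp_apply, h0]
    have e1 : ν (G.lab 1) = lam j := by rw [hlab, Function.comp_apply, h1]
    have hne : G.lab 0 ≠ G.lab 1 := fun h => h01 (G.lab_injective h)
    change G.graph.Adj v w ∨ (SimpleGraph.edge (G.lab 0) (G.lab 1)).Adj v w ↔ _
    beta_reduce
    rw [hadj, SimpleGraph.edge_adj, ← e0, ← e1, hinj.eq_iff, hinj.eq_iff, hinj.eq_iff,
      hinj.eq_iff]
    refine or_congr Iff.rfl ⟨fun h => ?_, fun h => ?_⟩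
    · simpa [eq_comm] using h.1
    · refine ⟨by simpa [eq_comm] using h, ?_⟩
      rcases h with ⟨rfl, rfl⟩ | ⟨rfl, rfl⟩
      exacts [hne, hne.symm]
  have := key.comp_perm ht π⁻¹
  convert! this using 1
  ext x
  simp

/-- The new vertex is isolated, which is why `R` is cut off at `x`. -/
theorem newVertex (ht : 2 ≤ t) (h : Constructible col R S lam) {x : α} (hx : x ∉ S) (i : Fin t) :
    Constructible col (fun a b => R a b ∧ a ≠ x ∧ b ≠ x) (insert x S)
      (Function.update lam i x) := by
  classical
  obtain ⟨T, G, hG, ν, hinj, hran, hcol, hadj, hlab⟩ := h.comp_perm ht (Equiv.swap 0 i)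
  have hνx : ∀ v, ν v ≠ x := fun v h => hx (hran ▸ h ▸ Set.mem_range_self v)
  have key : Constructible col (fun a b => R a b ∧ a ≠ x ∧ b ≠ x) (insert x S)
      (Function.update (lam ∘ Equiv.swap 0 i) 0 x) := by
    refine ⟨_, _, hG.new (col x), fun v => Option.elim v x ν, ?_, ?_, ?_, ?_, ?_⟩
    · rintro (_ | v) (_ | w) h
      · rfl
      · exact absurd h.symm (hνx w)
      · exact absurd h (hνx v)
      · exact congrArg some (hinj h)
    · rw [← hran]
      ext a
      constructor
      · rintro ⟨_ | v, rfl⟩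
        exacts [Or.inl rfl, Or.inr ⟨v, rfl⟩]
      · rintro (rfl | ⟨v, rfl⟩)
        exacts [⟨none, rfl⟩, ⟨some v, rfl⟩]
    · rintro (_ | v)
      exacts [rfl, hcol v]
    · change ∀ v w, (G.graph.map some).Adj v w ↔ _
      simp only [SimpleGraph.map_adj']
      rintro (_ | v) (_ | w)
      · simp
      · simp
      · simp
      · simp only [Option.elim_some, ← hadj]
        constructor
        · rintro ⟨-, v', w', h, hv, hw⟩
          cases hv
          cases hw
          exact ⟨h, hνx _, hνx _⟩
        · rintro ⟨h, -⟩
          exact ⟨fun h' => h.ne (Option.some.inj h'), v, w, h, rfl, rfl⟩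
    · intro j
      by_cases hj : j = 0
      · subst hj
        simp [BdGraph.newVertex]
      · simp [BdGraph.newVertex, hj, hlab]
  have := key.comp_perm ht (Equiv.swap 0 i)
  convert! this using 1
  rw [Function.update_comp_equiv]
  have h1 : (lam ∘ Equiv.swap 0 i) ∘ Equiv.swap 0 i = lam := by
    ext j
    simp
  rw [h1]
  simp

/-- Add a vertex whose neighbours are labelled, and let it take over the label `i`. -/
theorem insert_vertex (ht : 2 ≤ t) (h : Constructible col R S lam) (hsymm : ∀ {a b}, R a b → R b a) {x : α}
    (hx : x ∉ S) (hxx : ¬ R x x) (i : Fin t)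
    (hnbr : ∀ a ∈ S, R x a → ∃ j, j ≠ i ∧ lam j = a) :
    Constructible col R (insert x S) (Function.update lam i x) := by
  classical
  -- The edges from `x` are added one at a time; `J` collects the labels whose vertices are already
  -- joined to `x`.
  have key : ∀ J : Finset (Fin t), i ∉ J → Constructible col
      (fun a b => (R a b ∧ a ≠ x ∧ b ≠ x) ∨ (a = x ∧ ∃ j ∈ J, b = lam j) ∨
        (b = x ∧ ∃ j ∈ J, a = lam j)) (insert x S) (Function.update lam i x) := by
    intro J
    induction J using Finset.induction_on with
    | empty =>
      intro _
      exact (h.newVertex ht hx i).congr (by simp)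
    | insert j J hj ih =>
      intro hi
      rw [Finset.mem_insert, not_or] at hi
      refine ((ih hi.2).addEdge ht hi.1).congr fun a _ b _ => ?_
      rw [Function.update_self, Function.update_of_ne (Ne.symm hi.1)]
      simp only [Finset.exists_mem_insert]
      generalize (∃ j ∈ J, b = lam j) = P
      generalize (∃ j ∈ J, a = lam j) = Q
      generalize (b = lam j) = P'
      generalize (a = lam j) = Q'
      generalize (R a b ∧ a ≠ x ∧ b ≠ x) = C
      generalize (a = x) = A
      generalize (b = x) = B
      tauto
  refine (key (Finset.univ.filter fun j => j ≠ i ∧ R x (lam j)) (by simp)).congr ?_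
  have hlamS : ∀ j, lam j ∈ S := by
    obtain ⟨T, G, hG, ν, hinj, hran, hcol, hadj, hlab⟩ := h
    intro j
    rw [← hlab, ← hran]
    exact Set.mem_range_self _
  have hone : ∀ b ∈ S, (∃ j ∈ Finset.univ.filter fun j => j ≠ i ∧ R x (lam j), b = lam j) ↔
      R x b := by
    intro b hb
    constructor
    · rintro ⟨j, hj, rfl⟩
      exact (Finset.mem_filter.1 hj).2.2
    · intro hR
      obtain ⟨j, hj, rfl⟩ := hnbr b hb hR
      exact ⟨j, by simp [hj, hR], rfl⟩
  have hno : ¬ ∃ j ∈ Finset.univ.filter fun j => j ≠ i ∧ R x (lam j), x = lam j := by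
    rintro ⟨j, -, hj⟩
    exact hx (hj ▸ hlamS j)
  rintro a (rfl | ha) b (rfl | hb)
  · simp only [hno, hxx]
    simp
  · have hbx : b ≠ a := fun h => hx (h ▸ hb)
    rw [hone b hb]
    simp [hbx]
  · have hax : a ≠ b := fun h => hx (h ▸ ha)
    rw [hone a ha]
    simp only [ne_eq, hax, not_true, and_false, false_and, false_or, true_and]
    exact ⟨fun h => hsymm h, fun h => hsymm h⟩
  · have hax : a ≠ x := fun h => hx (h ▸ ha)
    have hbx : b ≠ x := fun h => hx (h ▸ hb)
    simp [hax, hbx]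

end Constructible

/-! ### Construction of one of the two paths -/

/-- Names for the vertices of the incidence graphs: `base i` is the final vertex with label `i`,
`spare s i` an initial one that loses its label. -/
inductive SyncName (t : ℕ) : Type
  | base (i : Fin t)
  | spare (s : Bool) (i : Fin t)
  | pair (s : Bool) (i j : Fin t)
  | step (s : Bool) (p : ℕ)
  | pos (s k : Bool) (p : ℕ)

/-- The label of the first vertex of the path `(s, k)`. -/
def startLabel (s k : Bool) : ℕ := 2 * s.toNat + k.toNat

/-- The label of the last vertex of the path `(s, k)`. -/
def endLabel (s k : Bool) : ℕ := 4 + (2 * s.toNat + k.toNat)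

theorem startLabel_lt (s k : Bool) : startLabel s k < 4 := by
  cases s <;> cases k <;> decide

theorem endLabel_lt (s k : Bool) : 4 ≤ endLabel s k ∧ endLabel s k < 8 := by
  cases s <;> cases k <;> decide

/-- Two labels belong to the start clique or to the end clique. -/
def JoinedLabels (i j : ℕ) : Prop :=
  i ≠ j ∧ (((i < 4 ∨ 8 ≤ i) ∧ i < 15 ∧ (j < 4 ∨ 8 ≤ j) ∧ j < 15) ∨
    (4 ≤ i ∧ i < 15 ∧ 4 ≤ j ∧ j < 15))

/-- The labels in the step `p` of the path `s`, which has `n` steps. -/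
def StepLabel (s : Bool) (n p m : ℕ) : Prop :=
  (∃ k, p = 0 ∧ m = startLabel s k) ∨ (∃ k, p + 1 = n ∧ m = endLabel s k) ∨
    ∃ c : Fin 3, m = 12 + c.val ∧ SyncVertex.HasKey s p c

theorem StepLabel.lt {s : Bool} {n p m : ℕ} (h : StepLabel s n p m) : m < 15 := by
  rcases h with ⟨k, -, rfl⟩ | ⟨k, -, rfl⟩ | ⟨c, rfl, -⟩
  · have := startLabel_lt s k
    omega
  · have := endLabel_lt s k
    omega
  · omega

namespace SyncName

variable {t : ℕ}

/-- The labels 0–3 and 4–7 are the first and last positions, 8–11 the hubs, 12–14 the keys. Labels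
15 and 16 also carry vertices, so the hyperedges begin at 17. -/
def color : SyncName t → Color
  | base i => if i.val < 17 then Color.vertex else Color.hyperedge
  | spare _ i => if i.val < 17 then Color.vertex else Color.hyperedge
  | pair _ _ _ => Color.hyperedge
  | step _ _ => Color.hyperedge
  | pos _ _ _ => Color.vertex

/-- The hyperedges of the side `s` and their vertices. -/
def Inc (s : Bool) (n : ℕ) : SyncName t → SyncName t → Prop
  | pair s' i j, base m => s' = s ∧ JoinedLabels i.val j.val ∧ (m = i ∨ m = j)
  | step s' p, base m => s' = s ∧ StepLabel s n p m.val
  | step s' p, pos s'' _ q => s' = s ∧ s'' = s ∧ (q = p ∨ q = p + 1)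
  | _, _ => False

def Adj (s : Bool) (n : ℕ) (a b : SyncName t) : Prop := Inc s n a b ∨ Inc s n b a

theorem Inc.color_eq {s : Bool} {n : ℕ} {a b : SyncName t} (h : Inc s n a b) :
    a.color = Color.hyperedge ∧ b.color = Color.vertex := by
  match a, b, h with
  | pair _ i j, base m, h =>
    refine ⟨rfl, if_pos ?_⟩
    obtain ⟨-, hj, hm⟩ := h
    unfold JoinedLabels at hj
    rcases hm with rfl | rfl <;> omega
  | step _ p, base m, h =>
    refine ⟨rfl, if_pos ?_⟩
    have := h.2.lt
    omega
  | step _ p, pos _ _ q, h => exact ⟨rfl, rfl⟩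

theorem Adj.symm {s : Bool} {n : ℕ} {a b : SyncName t} (h : Adj s n a b) : Adj s n b a :=
  Or.symm h

theorem Adj.color_ne {s : Bool} {n : ℕ} {a b : SyncName t} (h : Adj s n a b) :
    a.color ≠ b.color := by
  rcases h with h | h
  · rw [h.color_eq.1, h.color_eq.2]
    exact Color.noConfusion
  · rw [h.color_eq.1, h.color_eq.2]
    exact Color.noConfusion

theorem adj_iff_inc {s : Bool} {n : ℕ} {a b : SyncName t} (ha : a.color = Color.hyperedge) :
    Adj s n a b ↔ Inc s n a b := by
  refine ⟨fun h => h.resolve_right fun h' => ?_, Or.inl⟩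
  rw [h'.color_eq.2] at ha
  cases ha

/-- During the construction labels 15 and 16 carry the latest positions of the two strands, and 17
the latest hyperedge. All other labels stay where they are. -/
def IsRolling (i : Fin t) : Prop := 15 ≤ i.val ∧ i.val < 18

/-- The names in use after the pairs in `F`, `p` steps and `a` new vertices of each path have
been constructed. -/
def InStage (s : Bool) (F : Set (Fin t × Fin t)) (p a : ℕ) : SyncName t → Prop
  | base i => ¬ IsRolling i
  | spare s' i => s' = s ∧ IsRolling i
  | pair s' i j => s' = s ∧ (i, j) ∈ F
  | step s' q => s' = s ∧ q < p
  | pos s' _ q => s' = s ∧ 1 ≤ q ∧ q ≤ a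

def stage (s : Bool) (F : Set (Fin t × Fin t)) (p a : ℕ) : Set (SyncName t) :=
  {x | InStage s F p a x}

theorem stage_insert_pair (s : Bool) (F : Set (Fin t × Fin t)) (i j : Fin t) (p a : ℕ) :
    stage s (insert (i, j) F) p a = insert (pair s i j) (stage s F p a) := by
  ext x
  cases x <;> simp [stage, InStage, Set.mem_insert_iff]
  tauto

theorem stage_succ_left (s : Bool) (F : Set (Fin t × Fin t)) (p a : ℕ) :
    stage s F (p + 1) a = insert (step s p) (stage s F p a) := by
  ext x
  cases x <;> simp [stage, InStage, Set.mem_insert_iff]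
  rw [← and_or_left, Nat.le_iff_lt_or_eq, or_comm]

theorem stage_succ_right (s : Bool) (F : Set (Fin t × Fin t)) (p a : ℕ) :
    stage s F p (a + 1) =
      insert (pos s true (a + 1)) (insert (pos s false (a + 1)) (stage s F p a)) := by
  ext x
  rcases x with _ | _ | _ | _ | ⟨s', k, q⟩
  · simp [stage, InStage, Set.mem_insert_iff]
  · simp [stage, InStage, Set.mem_insert_iff]
  · simp [stage, InStage, Set.mem_insert_iff]
  · simp [stage, InStage, Set.mem_insert_iff]
  · cases k <;> simp [stage, InStage, Set.mem_insert_iff] <;> by_cases h : s' = s <;>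
      simp [h] <;> omega

/-- The names of the complete side `s` with `n + 1` steps. -/
def InSide (s : Bool) (n : ℕ) : SyncName t → Prop
  | base _ => True
  | spare s' i => s' = s ∧ IsRolling i
  | pair s' _ _ => s' = s
  | step s' q => s' = s ∧ q < n + 1
  | pos s' _ q => s' = s ∧ 1 ≤ q ∧ q ≤ n

def side (s : Bool) (n : ℕ) : Set (SyncName t) := {x | InSide s n x}

theorem side_eq (s : Bool) (n : ℕ) (h : 18 ≤ t) :
    (side s n : Set (SyncName t)) = insert (base ⟨17, by omega⟩) (insert (base ⟨16, by omega⟩)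
      (insert (base ⟨15, by omega⟩) (stage s Set.univ (n + 1) n))) := by
  ext x
  rcases x with i | _ | _ | _ | _
  · simp [side, InSide, stage, InStage, Set.mem_insert_iff, Fin.ext_iff, IsRolling]
    omega
  all_goals simp [side, InSide, stage, InStage, Set.mem_insert_iff]

theorem base_mem_side (s : Bool) (n : ℕ) (i : Fin t) : base i ∈ side s n := trivial

theorem not_adj_self {s : Bool} {n : ℕ} (a : SyncName t) : ¬ Adj s n a a :=
  fun h => h.color_ne rfl

theorem update_of_not_isRolling {lam : Fin t → SyncName t}
    (hlam : ∀ i, ¬ IsRolling i → lam i = base i) {j : Fin t} (hj : IsRolling j) (x : SyncName t) :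
    ∀ i, ¬ IsRolling i → Function.update lam j x i = base i := fun i hi => by
  rw [Function.update_of_ne (by rintro rfl; exact hi hj), hlam i hi]

end SyncName

section SideConstruction

open SyncName

variable {t : ℕ} [NeZero t]

theorem constructible_stage_zero (ht : 18 ≤ t) (s : Bool) (n : ℕ) :
    ∃ lam : Fin t → SyncName t, (∀ i, ¬ IsRolling i → lam i = base i) ∧
      Constructible color (Adj s n) (stage s ∅ 0 0) lam := by
  classical
  refine ⟨fun i => if IsRolling i then spare s i else base i, fun i hi => if_neg hi, ?_⟩
  have hinj : Function.Injective fun i : Fin t =>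
      if IsRolling i then spare s i else base i := by
    intro i j h
    by_cases hi : IsRolling i <;> by_cases hj : IsRolling j <;> simp [hi, hj] at h <;> exact h
  have hran : (Set.range fun i : Fin t => if IsRolling i then spare s i else base i) =
      stage s ∅ 0 0 := by
    ext x
    constructor
    · rintro ⟨i, rfl⟩
      by_cases hi : IsRolling i
      · simp [hi, stage, InStage]
      · simp [hi, stage, InStage]
    · rcases x with i | ⟨s', i⟩ | _ | _ | _
      · intro (hi : ¬ IsRolling i)
        exact ⟨i, if_neg hi⟩
      · rintro ⟨rfl, hi⟩
        exact ⟨i, if_pos hi⟩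
      · rintro ⟨-, h⟩
        exact h.elim
      · rintro ⟨-, h⟩
        omega
      · rintro ⟨-, h1, h2⟩
        omega
  rw [← hran]
  refine (Constructible.isolated 17 (by omega) hinj fun i => ?_).congr ?_
  · by_cases hi : IsRolling i <;> simp [hi, color]
  · rintro _ ⟨i, rfl⟩ _ ⟨j, rfl⟩
    by_cases hi : IsRolling i <;> by_cases hj : IsRolling j <;> simp [hi, hj, Adj, Inc]

/-- The clique vertices are permanently labelled, so each pair can be created at label 17,
displacing the previous one. Two labels without a common clique give an empty hyperedge, which does
not affect the width. -/
theorem constructible_stage_pairs (ht : 18 ≤ t) (s : Bool) (n : ℕ) :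
    ∃ lam : Fin t → SyncName t, (∀ i, ¬ IsRolling i → lam i = base i) ∧
      Constructible color (Adj s n) (stage s Set.univ 0 0) lam := by
  classical
  suffices h : ∀ F : Finset (Fin t × Fin t), ∃ lam : Fin t → SyncName t,
      (∀ i, ¬ IsRolling i → lam i = base i) ∧
        Constructible color (Adj s n) (stage s (F : Set (Fin t × Fin t)) 0 0) lam by
    simpa using h Finset.univ
  intro F
  induction F using Finset.induction_on with
  | empty => simpa using constructible_stage_zero ht s n
  | insert x F hx ih =>
    obtain ⟨lam, hlam, h⟩ := ih
    obtain ⟨i, j⟩ := x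
    have h17 : IsRolling (⟨17, by omega⟩ : Fin t) := ⟨by simp, by simp⟩
    refine ⟨Function.update lam ⟨17, by omega⟩ (pair s i j),
      update_of_not_isRolling hlam h17 _, ?_⟩
    rw [Finset.coe_insert, stage_insert_pair]
    refine h.insert_vertex (x := pair s i j) (by omega) Adj.symm (fun h => hx h.2) (not_adj_self _) _ ?_
    intro a _ hadj
    rw [adj_iff_inc rfl] at hadj
    match a, hadj with
    | base m, hm =>
      have hmr : ¬ IsRolling m := by
        obtain ⟨-, hj, hm⟩ := hm
        unfold JoinedLabels at hj
        unfold IsRolling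
        rcases hm with rfl | rfl <;> omega
      exact ⟨m, fun h => hmr (h ▸ h17), hlam m hmr⟩

/-- At its creation step `p` is joined to its keys and to position `p` of both strands; inner
positions `p + 1` join it when they are created. For `p = 0` the positions are start vertices with
permanent labels, hence the condition `1 ≤ p` in `hpos`. -/
theorem constructible_insert_step (ht : 18 ≤ t) {s : Bool} {n p : ℕ} {lam : Fin t → SyncName t}
    (hlam : ∀ i, ¬ IsRolling i → lam i = base i)
    (hpos : 1 ≤ p → lam ⟨15, by omega⟩ = pos s false p ∧ lam ⟨16, by omega⟩ = pos s true p)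
    (h : Constructible color (Adj s n) (stage s Set.univ p p) lam) :
    Constructible color (Adj s n) (stage s Set.univ (p + 1) p)
      (Function.update lam ⟨17, by omega⟩ (step s p)) := by
  rw [stage_succ_left]
  refine h.insert_vertex (x := step s p) (by omega) Adj.symm (fun h => lt_irrefl _ h.2) (not_adj_self _) _ ?_
  intro a ha hadj
  rw [adj_iff_inc rfl] at hadj
  match a, ha, hadj with
  | base m, _, hm =>
    have hmr : ¬ IsRolling m := by
      have := hm.2.lt
      unfold IsRolling
      omega
    exact ⟨m, fun h => hmr (h ▸ ⟨by simp, by simp⟩), hlam m hmr⟩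
  | pos s' k q, ha, hm =>
    obtain ⟨-, rfl, hq⟩ := hm
    obtain ⟨-, hq1, hq2⟩ := ha
    obtain rfl : q = p := by omega
    cases k
    · exact ⟨_, by simp, (hpos hq1).1⟩
    · exact ⟨_, by simp, (hpos hq1).2⟩

theorem constructible_stage_path (ht : 18 ≤ t) (s : Bool) (n p : ℕ) :
    ∃ lam : Fin t → SyncName t, (∀ i, ¬ IsRolling i → lam i = base i) ∧
      (1 ≤ p → lam ⟨15, by omega⟩ = pos s false p ∧ lam ⟨16, by omega⟩ = pos s true p) ∧
      Constructible color (Adj s n) (stage s Set.univ p p) lam := by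
  induction p with
  | zero =>
    obtain ⟨lam, h1, h2⟩ := constructible_stage_pairs ht s n
    exact ⟨lam, h1, by simp, h2⟩
  | succ p ih =>
    obtain ⟨lam, hlam, hpos, h⟩ := ih
    have h1 := constructible_insert_step ht hlam hpos h
    -- Position `p + 1` is also incident to step `p + 1`, but that step does not exist yet; step `p`
    -- still carries label 17.
    have hnbr : ∀ (k : Bool) (a : SyncName t), a ∈ stage s Set.univ (p + 1) p →
        Adj s n (pos s k (p + 1)) a → a = step s p := by
      intro k a ha hadj
      replace hadj := (adj_iff_inc (by
        cases hc : a.color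
        · exact absurd hc.symm hadj.color_ne
        · rfl)).1 hadj.symm
      match a, ha, hadj with
      | step s' q, ha, hm =>
        obtain ⟨rfl, -, hq⟩ := hm
        have := ha.2
        obtain rfl : q = p := by omega
        rfl
    have h2 := h1.insert_vertex (x := pos s false (p + 1)) (by omega) Adj.symm
      (fun h => by have := h.2.2; omega) (not_adj_self _) ⟨15, by omega⟩
      (fun a ha hadj => ⟨⟨17, by omega⟩, by simp, by
        rw [hnbr _ a ha hadj]; simp⟩)
    have h3 := h2.insert_vertex (x := pos s true (p + 1)) (by omega) Adj.symm
      (by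
        rintro (h | h)
        · cases h
        · have := h.2.2
          omega) (not_adj_self _) ⟨16, by omega⟩
      (fun a ha hadj => ⟨⟨17, by omega⟩, by simp, by
        rcases ha with rfl | ha
        · exact absurd rfl hadj.color_ne
        · rw [hnbr _ a ha hadj]
          rw [Function.update_of_ne (by simp), Function.update_self]⟩)
    refine ⟨_, ?_, fun _ => ⟨?_, ?_⟩, by rw [stage_succ_right]; exact h3⟩
    · exact update_of_not_isRolling (update_of_not_isRolling (update_of_not_isRolling hlam
        ⟨by simp, by simp⟩ _) ⟨by simp, by simp⟩ _) ⟨by simp, by simp⟩ _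
    · rw [Function.update_of_ne (by simp), Function.update_self]
    · rw [Function.update_self]

/-- After the last step, whose far ends are permanently labelled, the rolling labels are reset to
fresh isolated vertices. The labelled names are then the same for all sides and lengths, as gluing
requires. -/
theorem constructible_side (ht : 18 ≤ t) (s : Bool) (n : ℕ) :
    Constructible color (Adj s (n + 1)) (side s n) (base : Fin t → SyncName t) := by
  obtain ⟨lam, hlam, hpos, h⟩ := constructible_stage_path ht s (n + 1) n
  have h1 := constructible_insert_step ht hlam hpos h
  have hnbr : ∀ (i : Fin t), IsRolling i → ∀ a, ¬ Adj s (n + 1) (base i) a := by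
    intro i hi a hadj
    have hi := hi.1
    rcases hadj with hadj | hadj
    · cases a <;> exact hadj
    · match a, hadj with
      | pair _ j k, hm =>
        obtain ⟨-, hj, hm⟩ := hm
        unfold JoinedLabels at hj
        rcases hm with rfl | rfl <;> omega
      | step _ q, hm =>
        have := hm.2.lt
        omega
  have h2 := h1.insert_vertex (x := base ⟨15, by omega⟩) (by omega) Adj.symm
    (fun h => h ⟨by simp, by simp⟩) (not_adj_self _) ⟨15, by omega⟩
    (fun a _ hadj => absurd hadj (hnbr _ ⟨by simp, by simp⟩ a))
  have h3 := h2.insert_vertex (x := base ⟨16, by omega⟩) (by omega) Adj.symm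
    (by
      rintro (h | h)
      · simp at h
      · exact h ⟨by simp, by simp⟩) (not_adj_self _) ⟨16, by omega⟩
    (fun a _ hadj => absurd hadj (hnbr _ ⟨by simp, by simp⟩ a))
  have h4 := h3.insert_vertex (x := base ⟨17, by omega⟩) (by omega) Adj.symm
    (by
      rintro (h | h | h)
      · simp at h
      · simp at h
      · exact h ⟨by simp, by simp⟩) (not_adj_self _) ⟨17, by omega⟩
    (fun a _ hadj => absurd hadj (hnbr _ ⟨by simp, by simp⟩ a))
  rw [side_eq s n ht]
  convert! h4 using 1
  ext i
  by_cases h17 : i = ⟨17, by omega⟩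
  · subst h17
    simp
  by_cases h16 : i = ⟨16, by omega⟩
  · subst h16
    simp
  by_cases h15 : i = ⟨15, by omega⟩
  · subst h15
    simp
  rw [Function.update_of_ne h17, Function.update_of_ne h16, Function.update_of_ne h15,
    Function.update_of_ne h17, hlam]
  rintro ⟨h1, h2⟩
  rw [Fin.ext_iff] at h15 h16 h17
  simp only at h15 h16 h17
  omega

end SideConstruction

/-! ### Gluing of graphs and hypergraphs with named vertices -/

/-- If elements are identified exactly when their names agree, the names of the two parts induce
injective names of the glued type. -/
theorem Glued.exists_lift {α β γ : Type} (M : α → β → Prop) {f : α → γ} {g : β → γ}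
    (hf : Function.Injective f) (hg : Function.Injective g) (hM : ∀ a b, M a b ↔ f a = g b) :
    ∃ φ : Glued M → γ, Function.Injective φ ∧ (∀ a, φ (Glued.mk M (Sum.inl a)) = f a) ∧
      (∀ b, φ (Glued.mk M (Sum.inr b)) = g b) ∧ Set.range φ = Set.range f ∪ Set.range g := by
  refine ⟨Quot.lift (Sum.elim f g) ?_, ?_, fun _ => rfl, fun _ => rfl, ?_⟩
  · rintro _ _ ⟨a, b, h, rfl, rfl⟩
    exact (hM a b).1 h
  · rintro ⟨a | b⟩ ⟨a' | b'⟩ h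
    · exact congrArg (fun a => Glued.mk M (Sum.inl a)) (hf h)
    · exact Quot.sound ⟨a, b', (hM _ _).2 h, rfl, rfl⟩
    · exact (Quot.sound ⟨a', b, (hM _ _).2 h.symm, rfl, rfl⟩).symm
    · exact congrArg (fun a => Glued.mk M (Sum.inr a)) (hg h)
  · ext c
    constructor
    · rintro ⟨⟨a | b⟩, rfl⟩
      exacts [Or.inl ⟨a, rfl⟩, Or.inr ⟨b, rfl⟩]
    · rintro (⟨a, rfl⟩ | ⟨b, rfl⟩)
      exacts [⟨Glued.mk M (Sum.inl a), rfl⟩, ⟨Glued.mk M (Sum.inr b), rfl⟩]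

/-- The vertices and the hyperedges of `H` can be named by the elements of `S` of the respective
colour in such a way that the incidence is given by `M`. -/
def FinHypergraph.IsDescribed {α : Type} (col : α → Color) (S : Set α) (M : α → α → Prop)
    (H : FinHypergraph) : Prop :=
  ∃ (f : H.V → α) (g : H.E → α), Function.Injective f ∧
    Set.range f = {a | a ∈ S ∧ col a = Color.vertex} ∧ Function.Injective g ∧
    Set.range g = {a | a ∈ S ∧ col a = Color.hyperedge} ∧
    ∀ v e, v ∈ H.inc e ↔ M (g e) (f v)

theorem BdGraph.toHypergraph_lab_of_vertex {t : ℕ} {G : BdGraph t} {i : Fin t}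
    (h : G.color (G.lab i) = Color.vertex) :
    G.toHypergraph.lab i = Sum.inl ⟨G.lab i, h⟩ := dif_pos h

theorem BdGraph.toHypergraph_lab_of_hyperedge {t : ℕ} {G : BdGraph t} {i : Fin t}
    (h : G.color (G.lab i) = Color.hyperedge) :
    G.toHypergraph.lab i = Sum.inr ⟨G.lab i, h⟩ :=
  dif_neg (by rw [h]; exact Color.noConfusion)

theorem BdGraph.toHypergraph_lab_eq_inl {t : ℕ} {G : BdGraph t} {i : Fin t}
    {v : G.toHypergraph.V} : G.toHypergraph.lab i = Sum.inl v ↔ G.lab i = v.1 := by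
  obtain ⟨v, hv⟩ := v
  constructor
  · intro h
    cases hc : G.color (G.lab i) with
    | vertex =>
      rw [toHypergraph_lab_of_vertex hc] at h
      exact congrArg Subtype.val (Sum.inl_injective h)
    | hyperedge =>
      rw [toHypergraph_lab_of_hyperedge hc] at h
      cases h
  · rintro rfl
    exact toHypergraph_lab_of_vertex hv

theorem BdGraph.toHypergraph_lab_eq_inr {t : ℕ} {G : BdGraph t} {i : Fin t}
    {e : G.toHypergraph.E} : G.toHypergraph.lab i = Sum.inr e ↔ G.lab i = e.1 := by
  obtain ⟨e, he⟩ := e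
  constructor
  · intro h
    cases hc : G.color (G.lab i) with
    | vertex =>
      rw [toHypergraph_lab_of_vertex hc] at h
      cases h
    | hyperedge =>
      rw [toHypergraph_lab_of_hyperedge hc] at h
      exact congrArg Subtype.val (Sum.inr_injective h)
  · rintro rfl
    exact toHypergraph_lab_of_hyperedge he

theorem BdGraph.toHypergraph_isLeft {t : ℕ} (G : BdGraph t) (i : Fin t) :
    (G.toHypergraph.lab i).isLeft = true ↔ G.color (G.lab i) = Color.vertex := by
  by_cases h : G.color (G.lab i) = Color.vertex <;> simp [toHypergraph, h]

section NamedGraphs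

variable {t : ℕ} {α : Type} {col : α → Color} {R₁ R₂ : α → α → Prop} {S₁ S₂ : Set α}
  {lam : Fin t → α} {G₁ G₂ : BdGraph t}

theorem BdGraph.IsNamed.wellColored (h₁ : G₁.IsNamed col R₁ S₁ lam)
    (hR : ∀ a b, R₁ a b → col a ≠ col b) : G₁.WellColored := by
  obtain ⟨ν, -, -, hcol, hadj, -⟩ := h₁
  intro v w hvw
  rw [hcol, hcol]
  exact hR _ _ ((hadj v w).1 hvw)

theorem BdGraph.IsNamed.compatible (h₁ : G₁.IsNamed col R₁ S₁ lam)
    (h₂ : G₂.IsNamed col R₂ S₂ lam) : BdGraph.Compatible G₁ G₂ := by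
  obtain ⟨ν, -, -, hcol, -, hlab⟩ := h₁
  obtain ⟨ν', -, -, hcol', -, hlab'⟩ := h₂
  intro i
  rw [hcol, hcol', hlab, hlab']

theorem BdGraph.Compatible.gluable (h : BdGraph.Compatible G₁ G₂) :
    BdHypergraph.Gluable G₁.toHypergraph G₂.toHypergraph := by
  intro i
  rw [Bool.eq_iff_iff, BdGraph.toHypergraph_isLeft, BdGraph.toHypergraph_isLeft, h i]

/-- The adjacency of the names after gluing. -/
def gluedRel (R₁ R₂ : α → α → Prop) (S₁ S₂ : Set α) (a b : α) : Prop :=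
  (a ∈ S₁ ∧ b ∈ S₁ ∧ R₁ a b) ∨ (a ∈ S₂ ∧ b ∈ S₂ ∧ R₂ a b)

/-- By `hS` a name occurring on both sides is labelled, so equality of names is the same as being
identified. -/
theorem BdGraph.IsNamed.glue (h₁ : G₁.IsNamed col R₁ S₁ lam) (h₂ : G₂.IsNamed col R₂ S₂ lam)
    (hS : S₁ ∩ S₂ ⊆ Set.range lam) (h : BdGraph.Compatible G₁ G₂) :
    (G₁.glue G₂ h).IsNamed col (gluedRel R₁ R₂ S₁ S₂) (S₁ ∪ S₂) lam := by
  obtain ⟨ν, hinj, rfl, hcol, hadj, hlab⟩ := h₁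
  obtain ⟨ν', hinj', rfl, hcol', hadj', hlab'⟩ := h₂
  obtain ⟨φ, hφ, hl, hr, hran⟩ := Glued.exists_lift (SameLabel G₁ G₂) hinj hinj' (by
    intro a b
    constructor
    · rintro ⟨i, rfl, rfl⟩
      rw [hlab, hlab']
    · intro hab
      obtain ⟨i, hi⟩ := hS ⟨⟨a, rfl⟩, ⟨b, hab.symm⟩⟩
      exact ⟨i, hinj (by rw [hlab, hi]), hinj' (by rw [hlab', hi, hab])⟩)
  refine ⟨φ, hφ, hran, ?_, ?_, fun i => (hl _).trans (hlab i)⟩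
  · rintro ⟨v | v⟩
    · exact (hcol v).trans (congrArg col (hl v).symm)
    · exact (hcol' v).trans (congrArg col (hr v).symm)
  · intro (x : Glued (SameLabel G₁ G₂)) (y : Glued (SameLabel G₁ G₂))
    change ((G₁.graph ⊕g G₂.graph).map (Glued.mk (SameLabel G₁ G₂))).Adj x y ↔ _
    rw [SimpleGraph.map_adj']
    constructor
    · rintro ⟨-, v | v, w | w, hvw, rfl, rfl⟩
      · rw [hl, hl]
        exact Or.inl ⟨⟨v, rfl⟩, ⟨w, rfl⟩, (hadj v w).1 (by simpa using hvw)⟩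
      · simp at hvw
      · simp at hvw
      · rw [hr, hr]
        exact Or.inr ⟨⟨v, rfl⟩, ⟨w, rfl⟩, (hadj' v w).1 (by simpa using hvw)⟩
    · rintro (⟨⟨v, hv⟩, ⟨w, hw⟩, hR⟩ | ⟨⟨v, hv⟩, ⟨w, hw⟩, hR⟩)
      · rw [← hl] at hv hw
        obtain rfl := hφ hv
        obtain rfl := hφ hw
        rw [hl, hl, ← hadj] at hR
        refine ⟨fun h => hR.ne (hinj ?_), Sum.inl v, Sum.inl w, by simpa using hR, rfl, rfl⟩
        rw [← hl, ← hl, h]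
      · rw [← hr] at hv hw
        obtain rfl := hφ hv
        obtain rfl := hφ hw
        rw [hr, hr, ← hadj'] at hR
        refine ⟨fun h => hR.ne (hinj' ?_), Sum.inr v, Sum.inr w, by simpa using hR, rfl, rfl⟩
        rw [← hr, ← hr, h]

theorem range_comp_subtype {V : Type} {ν : V → α} {c : V → Color} (hc : ∀ v, c v = col (ν v))
    (x : Color) : Set.range (fun v : {v : V // c v = x} => ν v.1) =
      {a | a ∈ Set.range ν ∧ col a = x} := by
  ext a
  constructor
  · rintro ⟨⟨v, hv⟩, rfl⟩
    exact ⟨⟨v, rfl⟩, (hc v).symm.trans hv⟩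
  · rintro ⟨⟨v, rfl⟩, hv⟩
    exact ⟨⟨v, (hc v).trans hv⟩, rfl⟩

theorem BdGraph.IsNamed.toHypergraph_isDescribed (h : G₁.IsNamed col R₁ S₁ lam) :
    G₁.toHypergraph.toFinHypergraph.IsDescribed col S₁ R₁ := by
  obtain ⟨ν, hinj, rfl, hcol, hadj, hlab⟩ := h
  exact ⟨fun v => ν v.1, fun e => ν e.1, hinj.comp Subtype.val_injective,
    range_comp_subtype hcol _, hinj.comp Subtype.val_injective, range_comp_subtype hcol _,
    fun v e => hadj e.1 v.1⟩

/-- Vertices and hyperedges are glued by separate quotients, hence the two naming maps. The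
description is the one that gluing the graphs yields, so one computation of the width serves both
kinds of gluing. -/
theorem BdGraph.IsNamed.glue_toHypergraph_isDescribed (h₁ : G₁.IsNamed col R₁ S₁ lam)
    (h₂ : G₂.IsNamed col R₂ S₂ lam) (hS : S₁ ∩ S₂ ⊆ Set.range lam) :
    (G₁.toHypergraph.glue G₂.toHypergraph).toFinHypergraph.IsDescribed col (S₁ ∪ S₂)
      (gluedRel R₁ R₂ S₁ S₂) := by
  obtain ⟨ν, hinj, rfl, hcol, hadj, hlab⟩ := h₁
  obtain ⟨ν', hinj', rfl, hcol', hadj', hlab'⟩ := h₂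
  have hlabel : ∀ {a : G₁.V} {b : G₂.V}, ν a = ν' b → ∃ i, G₁.lab i = a ∧ G₂.lab i = b := by
    intro a b hab
    obtain ⟨i, hi⟩ := hS ⟨⟨a, rfl⟩, ⟨b, hab.symm⟩⟩
    exact ⟨i, hinj (by rw [hlab, hi]), hinj' (by rw [hlab', hi, hab])⟩
  obtain ⟨φ, hφ, hl, hr, hran⟩ := Glued.exists_lift
    (BdHypergraph.SameVertexLabel G₁.toHypergraph G₂.toHypergraph)
    (f := fun v : G₁.toHypergraph.V => ν v.1) (g := fun v : G₂.toHypergraph.V => ν' v.1)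
    (hinj.comp Subtype.val_injective) (hinj'.comp Subtype.val_injective) (by
      intro a b
      simp only [BdHypergraph.SameVertexLabel, BdGraph.toHypergraph_lab_eq_inl]
      refine ⟨?_, hlabel⟩
      rintro ⟨i, hi, hi'⟩
      rw [← hi, ← hi', hlab, hlab'])
  obtain ⟨ψ, hψ, hl', hr', hran'⟩ := Glued.exists_lift
    (BdHypergraph.SameEdgeLabel G₁.toHypergraph G₂.toHypergraph)
    (f := fun v : G₁.toHypergraph.E => ν v.1) (g := fun v : G₂.toHypergraph.E => ν' v.1)
    (hinj.comp Subtype.val_injective) (hinj'.comp Subtype.val_injective) (by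
      intro a b
      simp only [BdHypergraph.SameEdgeLabel, BdGraph.toHypergraph_lab_eq_inr]
      refine ⟨?_, hlabel⟩
      rintro ⟨i, hi, hi'⟩
      rw [← hi, ← hi', hlab, hlab'])
  have hunion : ∀ x, {a | a ∈ Set.range ν ∧ col a = x} ∪ {a | a ∈ Set.range ν' ∧ col a = x} =
      {a | a ∈ Set.range ν ∪ Set.range ν' ∧ col a = x} := by
    intro x
    ext a
    simp only [Set.mem_union, Set.mem_ofPred_eq]
    tauto
  refine ⟨φ, ψ, hφ, ?_, hψ, ?_, ?_⟩
  · exact hran.trans ((congrArg₂ _ (range_comp_subtype hcol _)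
      (range_comp_subtype hcol' _)).trans (hunion _))
  · exact hran'.trans ((congrArg₂ _ (range_comp_subtype hcol _)
      (range_comp_subtype hcol' _)).trans (hunion _))
  · intro x e
    constructor
    · rintro (⟨f, v, hv, rfl, rfl⟩ | ⟨f, v, hv, rfl, rfl⟩)
      · rw [hl, hl']
        exact Or.inl ⟨⟨_, rfl⟩, ⟨_, rfl⟩, (hadj _ _).1 hv⟩
      · rw [hr, hr']
        exact Or.inr ⟨⟨_, rfl⟩, ⟨_, rfl⟩, (hadj' _ _).1 hv⟩
    -- The colours of the names decide which of the underlying graph vertices are vertices and which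
    -- are hyperedges.
    · have hx : col (φ x) = Color.vertex := by
        obtain ⟨⟨v, hv⟩ | ⟨v, hv⟩⟩ := x
        · exact (congrArg col (hl ⟨v, hv⟩)).trans ((hcol v).symm.trans hv)
        · exact (congrArg col (hr ⟨v, hv⟩)).trans ((hcol' v).symm.trans hv)
      have he : col (ψ e) = Color.hyperedge := by
        obtain ⟨⟨v, hv⟩ | ⟨v, hv⟩⟩ := e
        · exact (congrArg col (hl' ⟨v, hv⟩)).trans ((hcol v).symm.trans hv)
        · exact (congrArg col (hr' ⟨v, hv⟩)).trans ((hcol' v).symm.trans hv)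
      rintro (⟨⟨f, hf⟩, ⟨v, hv⟩, hR⟩ | ⟨⟨f, hf⟩, ⟨v, hv⟩, hR⟩)
      · have hfc : G₁.color f = Color.hyperedge := by rw [hcol, hf, he]
        have hvc : G₁.color v = Color.vertex := by rw [hcol, hv, hx]
        exact Or.inl ⟨⟨f, hfc⟩, ⟨v, hvc⟩, (hadj _ _).2 (by rwa [hf, hv]),
          hψ ((hl' ⟨f, hfc⟩).trans hf), hφ ((hl ⟨v, hvc⟩).trans hv)⟩
      · have hfc : G₂.color f = Color.hyperedge := by rw [hcol', hf, he]
        have hvc : G₂.color v = Color.vertex := by rw [hcol', hv, hx]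
        exact Or.inr ⟨⟨f, hfc⟩, ⟨v, hvc⟩, (hadj' _ _).2 (by rwa [hf, hv]),
          hψ ((hr' ⟨f, hfc⟩).trans hf), hφ ((hr ⟨v, hvc⟩).trans hv)⟩

end NamedGraphs

/-! ### The hypergraph obtained by gluing the two sides -/

section Encoding

open SyncName

variable {t : ℕ} {n : Bool → ℕ}

/-- The name of a vertex of the double path. -/
def encodeVertex (ht : 18 ≤ t) : SyncVertex (fun s => n s + 1) → SyncName t
  | .hub i => base ⟨8 + i.val, by omega⟩
  | .key c => base ⟨12 + c.val, by omega⟩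
  | .pos s k q =>
    if q.val = 0 then base ⟨startLabel s k, by have := startLabel_lt s k; omega⟩
    else if q.val = n s + 1 then base ⟨endLabel s k, by have := endLabel_lt s k; omega⟩
    else pos s k q.val

theorem startLabel_inj {s k s' k' : Bool} (h : startLabel s k = startLabel s' k') :
    s = s' ∧ k = k' := by
  revert h
  cases s <;> cases k <;> cases s' <;> cases k' <;> decide

theorem endLabel_inj {s k s' k' : Bool} (h : endLabel s k = endLabel s' k') :
    s = s' ∧ k = k' := by
  revert h
  cases s <;> cases k <;> cases s' <;> cases k' <;> decide

variable (ht : 18 ≤ t)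

theorem encodeVertex_pos (s k : Bool) (q : Fin (n s + 1 + 1)) :
    (q.val = 0 ∧ ∃ h, encodeVertex ht (.pos s k q : SyncVertex fun s => n s + 1) =
      base ⟨startLabel s k, h⟩) ∨
    (q.val = n s + 1 ∧ ∃ h, encodeVertex ht (.pos s k q : SyncVertex fun s => n s + 1) =
      base ⟨endLabel s k, h⟩) ∨
    (1 ≤ q.val ∧ q.val ≤ n s ∧
      encodeVertex ht (.pos s k q : SyncVertex fun s => n s + 1) = pos s k q.val) := by
  have hs := startLabel_lt s k
  have he := endLabel_lt s k
  have hq := q.2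
  by_cases h0 : q.val = 0
  · exact Or.inl ⟨h0, by omega, if_pos h0⟩
  by_cases h1 : q.val = n s + 1
  · exact Or.inr (Or.inl ⟨h1, by omega, (if_neg h0).trans (if_pos h1)⟩)
  · exact Or.inr (Or.inr ⟨by omega, by omega, (if_neg h0).trans (if_neg h1)⟩)

theorem encodeVertex_injective :
    Function.Injective (encodeVertex ht : SyncVertex (fun s => n s + 1) → SyncName t) := by
  rintro (i | c | ⟨s, k, q⟩) (i' | c' | ⟨s', k', q'⟩) h
  · rw [encodeVertex, encodeVertex, base.injEq, Fin.mk.injEq] at h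
    exact congrArg _ (Fin.ext (by omega))
  · rw [encodeVertex, encodeVertex, base.injEq, Fin.mk.injEq] at h
    omega
  · have hs := startLabel_lt s' k'
    have he := endLabel_lt s' k'
    rcases encodeVertex_pos ht s' k' q' with ⟨_, _, e⟩ | ⟨_, _, e⟩ | ⟨_, _, e⟩ <;>
      rw [e, encodeVertex] at h <;> simp at h <;> omega
  · rw [encodeVertex, encodeVertex, base.injEq, Fin.mk.injEq] at h
    omega
  · rw [encodeVertex, encodeVertex, base.injEq, Fin.mk.injEq] at h
    exact congrArg _ (Fin.ext (by omega))
  · have hs := startLabel_lt s' k'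
    have he := endLabel_lt s' k'
    rcases encodeVertex_pos ht s' k' q' with ⟨_, _, e⟩ | ⟨_, _, e⟩ | ⟨_, _, e⟩ <;>
      rw [e, encodeVertex] at h <;> simp at h <;> omega
  · have hs := startLabel_lt s k
    have he := endLabel_lt s k
    rcases encodeVertex_pos ht s k q with ⟨_, _, e⟩ | ⟨_, _, e⟩ | ⟨_, _, e⟩ <;>
      rw [e, encodeVertex] at h <;> simp at h <;> omega
  · have hs := startLabel_lt s k
    have he := endLabel_lt s k
    rcases encodeVertex_pos ht s k q with ⟨_, _, e⟩ | ⟨_, _, e⟩ | ⟨_, _, e⟩ <;>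
      rw [e, encodeVertex] at h <;> simp at h <;> omega
  · have key : s = s' ∧ k = k' ∧ q.val = q'.val := by
      have hs := startLabel_lt s k
      have he := endLabel_lt s k
      have hs' := startLabel_lt s' k'
      have he' := endLabel_lt s' k'
      rcases encodeVertex_pos ht s k q with ⟨h0, _, e⟩ | ⟨h0, _, e⟩ | ⟨_, _, e⟩ <;>
        rcases encodeVertex_pos ht s' k' q' with ⟨h0', _, e'⟩ | ⟨h0', _, e'⟩ | ⟨_, _, e'⟩ <;>
        rw [e, e'] at h <;> simp only [base.injEq, Fin.mk.injEq, pos.injEq, reduceCtorEq] at h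
      · exact ⟨(startLabel_inj h).1, (startLabel_inj h).2, h0.trans h0'.symm⟩
      · omega
      · omega
      · obtain ⟨rfl, rfl⟩ := endLabel_inj h
        exact ⟨rfl, rfl, h0.trans h0'.symm⟩
      · exact h
    obtain ⟨rfl, rfl, hq⟩ := key
    rw [Fin.ext hq]

theorem encodeVertex_mem_side (v : SyncVertex (fun s => n s + 1)) :
    ∃ s, encodeVertex ht v ∈ side s (n s) := by
  rcases v with i | c | ⟨s, k, q⟩
  · exact ⟨false, base_mem_side _ _ _⟩
  · exact ⟨false, base_mem_side _ _ _⟩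
  · rcases encodeVertex_pos ht s k q with ⟨_, _, e⟩ | ⟨_, _, e⟩ | ⟨h1, h2, e⟩ <;> rw [e]
    · exact ⟨false, base_mem_side _ _ _⟩
    · exact ⟨false, base_mem_side _ _ _⟩
    · exact ⟨s, rfl, h1, h2⟩

theorem isStart_iff (v : SyncVertex (fun s => n s + 1)) :
    v.IsStart ↔ ∃ i, encodeVertex ht v = base i ∧ (i.val < 4 ∨ 8 ≤ i.val) ∧ i.val < 15 := by
  rcases v with i | c | ⟨s, k, q⟩
  · refine ⟨fun _ => ⟨_, rfl, ?_, ?_⟩, fun _ => trivial⟩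
    · right; change 8 ≤ 8 + i.val; omega
    · change 8 + i.val < 15; omega
  · refine ⟨fun _ => ⟨_, rfl, ?_, ?_⟩, fun _ => trivial⟩
    · right; change 8 ≤ 12 + c.val; omega
    · change 12 + c.val < 15; omega
  · have hs := startLabel_lt s k
    have he := endLabel_lt s k
    change q.val = 0 ↔ _
    rcases encodeVertex_pos ht s k q with ⟨h, _, e⟩ | ⟨h, _, e⟩ | ⟨h, _, e⟩ <;> rw [e]
    · refine ⟨fun _ => ⟨_, rfl, ?_, ?_⟩, fun _ => h⟩
      · left; exact hs
      · change startLabel s k < 15; omega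
    · refine ⟨fun _ => by omega, ?_⟩
      rintro ⟨i, hi, h⟩
      rw [base.injEq] at hi
      subst hi
      simp only at h
      omega
    · refine ⟨fun _ => by omega, ?_⟩
      rintro ⟨i, hi, -⟩
      cases hi

theorem isEnd_iff (v : SyncVertex (fun s => n s + 1)) :
    v.IsEnd ↔ ∃ i, encodeVertex ht v = base i ∧ 4 ≤ i.val ∧ i.val < 15 := by
  rcases v with i | c | ⟨s, k, q⟩
  · refine ⟨fun _ => ⟨_, rfl, ?_, ?_⟩, fun _ => trivial⟩
    · change 4 ≤ 8 + i.val; omega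
    · change 8 + i.val < 15; omega
  · refine ⟨fun _ => ⟨_, rfl, ?_, ?_⟩, fun _ => trivial⟩
    · change 4 ≤ 12 + c.val; omega
    · change 12 + c.val < 15; omega
  · have hs := startLabel_lt s k
    have he := endLabel_lt s k
    change q.val = n s + 1 ↔ _
    rcases encodeVertex_pos ht s k q with ⟨h, _, e⟩ | ⟨h, _, e⟩ | ⟨h, _, e⟩ <;> rw [e]
    · refine ⟨fun _ => by omega, ?_⟩
      rintro ⟨i, hi, h⟩
      rw [base.injEq] at hi
      subst hi
      simp only at h
      omega
    · refine ⟨fun _ => ⟨_, rfl, ?_, ?_⟩, fun _ => h⟩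
      · exact he.1
      · change endLabel s k < 15; omega
    · refine ⟨fun _ => by omega, ?_⟩
      rintro ⟨i, hi, -⟩
      cases hi

theorem exists_startLabel {i : ℕ} (hi : i < 4) : ∃ s k, startLabel s k = i := by
  have : i = 0 ∨ i = 1 ∨ i = 2 ∨ i = 3 := by omega
  rcases this with rfl | rfl | rfl | rfl
  exacts [⟨false, false, rfl⟩, ⟨false, true, rfl⟩, ⟨true, false, rfl⟩, ⟨true, true, rfl⟩]

theorem exists_encodeVertex_eq (i : Fin t) (hi : i.val < 15) :
    ∃ v : SyncVertex (fun s => n s + 1), encodeVertex ht v = base i := by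
  by_cases h4 : i.val < 4
  · obtain ⟨s, k, h⟩ := exists_startLabel h4
    exact ⟨.pos s k 0, congrArg base (Fin.ext h)⟩
  by_cases h8 : i.val < 8
  · obtain ⟨s, k, h⟩ := exists_startLabel (i := i.val - 4) (by omega)
    refine ⟨.pos s k (Fin.last _), ?_⟩
    have : endLabel s k = i.val := by
      change 4 + startLabel s k = i.val
      omega
    rcases encodeVertex_pos ht s k (Fin.last (n s + 1)) with ⟨h0, -⟩ | ⟨-, _, e⟩ | ⟨-, h2, -⟩
    · rw [Fin.val_last] at h0; omega
    · rw [e]; exact congrArg base (Fin.ext this)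
    · rw [Fin.val_last] at h2; omega
  by_cases h12 : i.val < 12
  · exact ⟨.hub ⟨i.val - 8, by omega⟩, congrArg base (Fin.ext (by
      change 8 + (i.val - 8) = i.val; omega))⟩
  · exact ⟨.key ⟨i.val - 12, by omega⟩, congrArg base (Fin.ext (by
      change 12 + (i.val - 12) = i.val; omega))⟩

theorem joined_iff (a b : SyncVertex (fun s => n s + 1)) :
    a.Joined b ↔ ∃ i j, encodeVertex ht a = base i ∧ encodeVertex ht b = base j ∧
      JoinedLabels i.val j.val := by
  constructor
  · rintro ⟨hne, ⟨ha, hb⟩ | ⟨ha, hb⟩⟩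
    · obtain ⟨i, hi, hi'⟩ := (isStart_iff ht a).1 ha
      obtain ⟨j, hj, hj'⟩ := (isStart_iff ht b).1 hb
      refine ⟨i, j, hi, hj, fun h => hne (encodeVertex_injective ht ?_),
        Or.inl ⟨hi'.1, hi'.2, hj'.1, hj'.2⟩⟩
      rw [hi, hj, Fin.ext h]
    · obtain ⟨i, hi, hi'⟩ := (isEnd_iff ht a).1 ha
      obtain ⟨j, hj, hj'⟩ := (isEnd_iff ht b).1 hb
      refine ⟨i, j, hi, hj, fun h => hne (encodeVertex_injective ht ?_),
        Or.inr ⟨hi'.1, hi'.2, hj'.1, hj'.2⟩⟩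
      rw [hi, hj, Fin.ext h]
  · rintro ⟨i, j, hi, hj, hne, h⟩
    refine ⟨?_, ?_⟩
    · rintro rfl
      rw [hi, base.injEq] at hj
      exact hne (congrArg _ hj)
    · rcases h with ⟨h1, h2, h3, h4⟩ | ⟨h1, h2, h3, h4⟩
      · exact Or.inl ⟨(isStart_iff ht a).2 ⟨i, hi, h1, h2⟩, (isStart_iff ht b).2 ⟨j, hj, h3, h4⟩⟩
      · exact Or.inr ⟨(isEnd_iff ht a).2 ⟨i, hi, h1, h2⟩, (isEnd_iff ht b).2 ⟨j, hj, h3, h4⟩⟩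

theorem inc_step_iff {s : Bool} {p : ℕ} (hp : p < n s + 1) (v : SyncVertex (fun s => n s + 1)) :
    Inc s (n s + 1) (step s p) (encodeVertex ht v) ↔ v.InStep s p := by
  rcases v with i | c | ⟨s', k, q⟩
  · refine ⟨?_, False.elim⟩
    rintro ⟨-, ⟨k, -, h⟩ | ⟨k, -, h⟩ | ⟨c, h, -⟩⟩ <;> simp only at h
    · have := startLabel_lt s k
      omega
    · have := endLabel_lt s k
      omega
    · omega
  · constructor
    · rintro ⟨-, ⟨k, -, h⟩ | ⟨k, -, h⟩ | ⟨c', h, h'⟩⟩ <;> simp only at h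
      · have := startLabel_lt s k
        omega
      · have := endLabel_lt s k
        omega
      · obtain rfl : c = c' := Fin.ext (by omega)
        exact h'
    · exact fun h => ⟨rfl, Or.inr (Or.inr ⟨c, rfl, h⟩)⟩
  · have hs := startLabel_lt s' k
    have he := endLabel_lt s' k
    change _ ↔ s' = s ∧ (q.val = p ∨ q.val = p + 1)
    rcases encodeVertex_pos ht s' k q with ⟨hq, _, e⟩ | ⟨hq, _, e⟩ | ⟨_, _, e⟩ <;> rw [e]
    · constructor
      · rintro ⟨-, ⟨k, h0, h⟩ | ⟨k, -, h⟩ | ⟨c, h, -⟩⟩ <;> simp only at h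
        · exact ⟨(startLabel_inj h).1, Or.inl (hq.trans h0.symm)⟩
        · have := endLabel_lt s k
          omega
        · omega
      · rintro ⟨rfl, h⟩
        exact ⟨rfl, Or.inl ⟨k, by omega, rfl⟩⟩
    · constructor
      · rintro ⟨-, ⟨k, -, h⟩ | ⟨k, h0, h⟩ | ⟨c, h, -⟩⟩ <;> simp only at h
        · have := startLabel_lt s k
          omega
        · obtain ⟨rfl, rfl⟩ := endLabel_inj h
          exact ⟨rfl, Or.inr (hq.trans h0.symm)⟩
        · omega
      · rintro ⟨rfl, h⟩
        exact ⟨rfl, Or.inr (Or.inl ⟨k, by omega, rfl⟩)⟩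
    · exact ⟨fun h => h.2, fun h => ⟨rfl, h⟩⟩

theorem inc_mem_side {s : Bool} {e : SyncName t} {v : SyncVertex (fun s => n s + 1)}
    (h : Inc s (n s + 1) e (encodeVertex ht v)) : encodeVertex ht v ∈ side s (n s) := by
  obtain ⟨s', hs'⟩ := encodeVertex_mem_side ht v
  revert h hs'
  generalize encodeVertex ht v = x
  intro h hs'
  match e, x, h with
  | pair _ i j, base m, h => exact base_mem_side _ _ _
  | step _ p, base m, h => exact base_mem_side _ _ _
  | step _ p, pos _ _ q, h =>
    obtain ⟨-, rfl, -⟩ := h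
    obtain ⟨rfl, h⟩ := hs'
    exact ⟨rfl, h⟩

/-- Names that do not encode a vertex of the double path, such as spare vertices and unused labels,
lie in no hyperedge and vanish with the isolated vertices. -/
theorem exists_encodeVertex_of_inc {s : Bool} {e x : SyncName t} (hx : x ∈ side s (n s))
    (h : Inc s (n s + 1) e x) : ∃ v : SyncVertex (fun s => n s + 1), encodeVertex ht v = x := by
  match e, x, h with
  | pair _ i j, base m, h =>
    refine exists_encodeVertex_eq ht m ?_
    obtain ⟨-, hj, hm⟩ := h
    unfold JoinedLabels at hj
    rcases hm with rfl | rfl <;> omega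
  | step _ p, base m, h => exact exists_encodeVertex_eq ht m h.2.lt
  | step _ p, pos s' k q, h =>
    obtain ⟨-, rfl, -⟩ := h
    obtain ⟨-, h1, h2⟩ := hx
    refine ⟨.pos s' k ⟨q, by omega⟩, (if_neg ?_).trans (if_neg ?_)⟩
    · change q ≠ 0; omega
    · change q ≠ _; omega

/-- The incidence of the names in the glued hypergraph. -/
def syncRel (n : Bool → ℕ) : SyncName t → SyncName t → Prop :=
  gluedRel (Adj false (n false + 1)) (Adj true (n true + 1)) (side false (n false))
    (side true (n true))

def syncNames (n : Bool → ℕ) : Set (SyncName t) := side false (n false) ∪ side true (n true)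

theorem mem_syncNames {x : SyncName t} : x ∈ syncNames n ↔ ∃ s, x ∈ side s (n s) := by
  simp [syncNames]

theorem syncRel_iff {a b : SyncName t} (ha : a.color = Color.hyperedge) :
    syncRel n a b ↔ ∃ s, a ∈ side s (n s) ∧ b ∈ side s (n s) ∧ Inc s (n s + 1) a b := by
  simp [syncRel, gluedRel, adj_iff_inc ha]

theorem syncRel_pair_iff (s : Bool) (i j : Fin t) (v : SyncVertex (fun s => n s + 1)) :
    syncRel n (pair s i j) (encodeVertex ht v) ↔
      JoinedLabels i.val j.val ∧ (encodeVertex ht v = base i ∨ encodeVertex ht v = base j) := by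
  rw [syncRel_iff rfl]
  constructor
  · rintro ⟨s', rfl, -, h⟩
    revert h
    generalize encodeVertex ht v = x
    intro h
    match x, h with
    | base m, h => exact ⟨h.2.1, h.2.2.imp (congrArg _) (congrArg _)⟩
  · rintro ⟨hj, h⟩
    have : Inc s (n s + 1) (pair s i j) (encodeVertex ht v) := by
      rcases h with h | h <;> rw [h]
      exacts [⟨rfl, hj, Or.inl rfl⟩, ⟨rfl, hj, Or.inr rfl⟩]
    exact ⟨s, rfl, inc_mem_side ht this, this⟩

theorem syncRel_step_iff (s : Bool) (p : ℕ) (v : SyncVertex (fun s => n s + 1)) :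
    syncRel n (step s p) (encodeVertex ht v) ↔ p < n s + 1 ∧ v.InStep s p := by
  rw [syncRel_iff rfl]
  constructor
  · rintro ⟨s', ⟨rfl, hp⟩, -, h⟩
    exact ⟨hp, (inc_step_iff ht hp v).1 h⟩
  · rintro ⟨hp, h⟩
    have := (inc_step_iff ht hp v).2 h
    exact ⟨s, ⟨rfl, hp⟩, inc_mem_side ht this, this⟩

/-- Removing isolated vertices thus deletes no encoded vertex. -/
theorem SyncVertex.exists_mem_verts (v : SyncVertex (fun s => n s + 1)) :
    ∃ e : SyncEdge (fun s => n s + 1), v ∈ e.verts := by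
  rcases v with i | c | ⟨s, k, q⟩
  · exact ⟨.pair (.hub i) (.key 0), ⟨by simp, Or.inl ⟨trivial, trivial⟩⟩, Or.inl rfl⟩
  · exact ⟨.pair (.key c) (.hub 0), ⟨by simp, Or.inl ⟨trivial, trivial⟩⟩, Or.inl rfl⟩
  · have hq := q.2
    by_cases h : q.val = 0
    · exact ⟨.step s 0, rfl, Or.inl h⟩
    · exact ⟨.step s ⟨q.val - 1, by omega⟩, rfl,
        Or.inr (by change q.val = q.val - 1 + 1; omega)⟩

theorem encodeVertex_color (v : SyncVertex (fun s => n s + 1)) :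
    (encodeVertex ht v).color = Color.vertex := by
  rcases v with i | c | ⟨s, k, q⟩
  · refine if_pos ?_
    change 8 + i.val < 17
    omega
  · refine if_pos ?_
    change 12 + c.val < 17
    omega
  · have hs := startLabel_lt s k
    have he := endLabel_lt s k
    rcases encodeVertex_pos ht s k q with ⟨hq, _, e⟩ | ⟨hq, _, e⟩ | ⟨_, _, e⟩ <;> rw [e]
    · refine if_pos ?_
      change startLabel s k < 17
      omega
    · refine if_pos ?_
      change endLabel s k < 17
      omega
    · rfl

theorem exists_name_of_edge (e' : SyncEdge (fun s => n s + 1)) (hne : e'.verts.Nonempty) :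
    ∃ x : SyncName t, x ∈ syncNames n ∧ x.color = Color.hyperedge ∧
      ∀ v, syncRel n x (encodeVertex ht v) ↔ v ∈ e'.verts := by
  rcases e' with ⟨a, b⟩ | ⟨s, p⟩
  · obtain ⟨v, hab, -⟩ := hne
    obtain ⟨i, j, hi, hj, hij⟩ := (joined_iff ht a b).1 hab
    -- Both sides contain a copy of every pair; the left one is chosen.
    refine ⟨pair false i j, mem_syncNames.2 ⟨false, rfl⟩, rfl, fun v => ?_⟩
    rw [syncRel_pair_iff, ← hi, ← hj, (encodeVertex_injective ht).eq_iff,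
      (encodeVertex_injective ht).eq_iff]
    exact ⟨fun h => ⟨hab, h.2⟩, fun h => ⟨hij, h.2⟩⟩
  · refine ⟨step s p.val, mem_syncNames.2 ⟨s, rfl, p.2⟩, rfl, fun v => ?_⟩
    rw [syncRel_step_iff]
    exact ⟨fun h => h.2, fun h => ⟨p.2, h⟩⟩

/-- Nonemptiness excludes the dummy hyperedges: pairs of labels without a common clique and the
labels from 17 on. -/
theorem exists_edge_of_name (x : SyncName t) (hx : x.color = Color.hyperedge)
    (hne : ∃ y, syncRel n x y) : ∃ e' : SyncEdge (fun s => n s + 1),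
      ∀ v, syncRel n x (encodeVertex ht v) ↔ v ∈ e'.verts := by
  obtain ⟨y, hy⟩ := hne
  obtain ⟨s, hxs, -, h⟩ := (syncRel_iff hx).1 hy
  match x, y, h with
  | pair s' i j, base m, h =>
    obtain ⟨-, hij, -⟩ := h
    have hij' := hij
    unfold JoinedLabels at hij'
    obtain ⟨a, ha⟩ := exists_encodeVertex_eq (n := n) ht i (by omega)
    obtain ⟨b, hb⟩ := exists_encodeVertex_eq (n := n) ht j (by omega)
    refine ⟨.pair a b, fun v => ?_⟩
    rw [syncRel_pair_iff, ← ha, ← hb, (encodeVertex_injective ht).eq_iff,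
      (encodeVertex_injective ht).eq_iff]
    exact ⟨fun h => ⟨(joined_iff ht a b).2 ⟨i, j, ha, hb, hij⟩, h.2⟩, fun h => ⟨hij, h.2⟩⟩
  | step s' p, y, h =>
    obtain ⟨rfl, hp⟩ := hxs
    refine ⟨.step s' ⟨p, hp⟩, fun v => ?_⟩
    rw [syncRel_step_iff]
    exact ⟨fun h => h.2, fun h => ⟨hp, h⟩⟩

end Encoding

/-! ### The width of the glued hypergraph -/

section Width

open SyncName

variable {t : ℕ} {n : Bool → ℕ}

theorem exists_similarity (ht : 18 ≤ t) {H : FinHypergraph}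
    (hH : H.IsDescribed SyncName.color (syncNames n : Set (SyncName t)) (syncRel n)) :
    ∃ φ, FinHypergraph.IsSimilarity H.removeIsolated (syncHypergraph fun s => n s + 1) φ := by
  obtain ⟨f, g, hf, hfr, hg, hgr, hinc⟩ := hH
  have hcolor : ∀ e, (g e).color = Color.hyperedge := fun e => by
    have : g e ∈ Set.range g := ⟨e, rfl⟩
    rw [hgr] at this
    exact this.2
  have hedge : ∀ e' : SyncEdge (fun s => n s + 1), e'.verts.Nonempty →
      ∃ e, ∀ v, syncRel n (g e) (encodeVertex ht v) ↔ v ∈ e'.verts := by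
    intro e' hne
    obtain ⟨x, hx, hxc, h⟩ := exists_name_of_edge ht e' hne
    have : x ∈ Set.range g := hgr ▸ ⟨hx, hxc⟩
    obtain ⟨e, rfl⟩ := this
    exact ⟨e, h⟩
  let F : H.removeIsolated.V → SyncName t := fun v => f v.1
  have hF : Function.Injective F := hf.comp Subtype.val_injective
  have hrange : Set.range F = Set.range (encodeVertex (n := n) ht) := by
    ext x
    constructor
    · rintro ⟨⟨v, e, hve⟩, rfl⟩
      rw [hinc, syncRel_iff (hcolor e)] at hve
      obtain ⟨s, -, hx, h⟩ := hve
      exact exists_encodeVertex_of_inc ht hx h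
    · rintro ⟨v, rfl⟩
      have : encodeVertex ht v ∈ Set.range f := by
        rw [hfr]
        exact ⟨mem_syncNames.2 (encodeVertex_mem_side ht v), encodeVertex_color ht v⟩
      obtain ⟨u, hu⟩ := this
      obtain ⟨e', he'⟩ := v.exists_mem_verts
      obtain ⟨e, he⟩ := hedge e' ⟨v, he'⟩
      exact ⟨⟨u, e, by rw [hinc, hu, he]; exact he'⟩, hu⟩
  let φ : H.removeIsolated.V ≃ SyncVertex (fun s => n s + 1) :=
    (Equiv.ofInjective F hF).trans ((Equiv.setCongr hrange).trans
      (Equiv.ofInjective _ (encodeVertex_injective ht)).symm)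
  have hφ : ∀ v, encodeVertex ht (φ v) = f v.1 := fun v =>
    Equiv.apply_ofInjective_symm (encodeVertex_injective ht) _
  refine ⟨φ, fun e hne => ?_, fun e' hne => ?_⟩
  · obtain ⟨v, hv⟩ := hne
    obtain ⟨e', he'⟩ := exists_edge_of_name (n := n) ht (g e) (hcolor e) ⟨_, (hinc v.1 e).1 hv⟩
    refine ⟨e', fun v => (hinc v.1 e).trans ?_⟩
    rw [← hφ]
    exact he' _
  · obtain ⟨e, he⟩ := hedge e' hne
    refine ⟨e, fun v => (hinc v.1 e).trans ?_⟩
    rw [← hφ]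
    exact he _

/-- Three implications close a cycle: hypertree width at most four bounds the fractional width, this
forces equal lengths, and equal lengths bound the hypertree width. -/
theorem hypertreeWidthLE_iff (ht : 18 ≤ t) {H : FinHypergraph}
    (hH : H.IsDescribed SyncName.color (syncNames n : Set (SyncName t)) (syncRel n)) :
    (H.HypertreeWidthLE 4 ↔ n false = n true) ∧
      (H.FractionalHypertreeWidthLE 4 ↔ n false = n true) := by
  obtain ⟨φ, hφ⟩ := exists_similarity ht hH
  have h1 : H.HypertreeWidthLE 4 → H.FractionalHypertreeWidthLE 4 := fun h => by
    have := FinHypergraph.HasHypertreeDecomposition.fractional (H := H.removeIsolated) h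
    exact_mod_cast this
  have h2 : H.FractionalHypertreeWidthLE 4 → n false = n true := fun h =>
    Nat.succ_injective (eq_of_hasFractionalHypertreeDecomposition
      (hφ.hasFractionalHypertreeDecomposition h))
  have h3 : n false = n true → H.HypertreeWidthLE 4 := fun h => by
    have hn : (fun s => n s + 1) = fun _ => n false + 1 := by
      funext s
      cases s
      exacts [rfl, congrArg _ h.symm]
    have := syncHypergraph_hasHypertreeDecomposition (n false)
    rw [← hn] at this
    exact hφ.symm.hasHypertreeDecomposition this
  exact ⟨⟨fun h => h2 (h1 h), h3⟩, ⟨h2, fun h => h1 (h3 h)⟩⟩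

end Width

/-! ### Infinite index -/

/-- Membership in `parseTrees F` asserts only that some generated graph is suitable; uniqueness
turns this into a statement about the given graph, so recognizing implies deciding. -/
theorem Generates.unique {t : ℕ} [NeZero t] {T : LTree (ParseOp t)} {G G' : BdGraph t}
    (h : Generates T G) (h' : Generates T G') : G = G' := by
  induction h generalizing G' with
  | empty n => cases h'; rfl
  | edge _ ih => cases h' with | edge h => rw [ih h]
  | new c _ ih => cases h' with | new _ h => rw [ih h]
  | rotate _ ih => cases h' with | rotate h => rw [ih h]
  | swap _ ih => cases h' with | swap h => rw [ih h]
  | glue hc _ _ ih₁ ih₂ =>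
    cases h' with
    | glue hc' h₁ h₂ =>
      obtain rfl := ih₁ h₁
      obtain rfl := ih₂ h₂
      rfl

theorem TreeAutomaton.Recognizes.decides {t : ℕ} [NeZero t] {A : TreeAutomaton (ParseOp t)}
    {F : Set (BdHypergraph t)} (h : A.Recognizes (parseTrees F)) : A.Decides F := by
  intro T G hG hwc
  rw [h T]
  constructor
  · rintro ⟨G', hG', -, hF⟩
    rwa [hG.unique hG']
  · exact fun hF => ⟨G, hG, hwc, hF⟩

theorem infinite_index_of_described {t : ℕ} [NeZero t] (ht : 18 ≤ t) (F : Set (BdHypergraph t))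
    (hF : ∀ (H : BdHypergraph t) (n : Bool → ℕ),
      H.toFinHypergraph.IsDescribed SyncName.color (syncNames n : Set (SyncName t)) (syncRel n) →
        (H ∈ F ↔ n false = n true)) :
    HasInfiniteIndexOver (BdHypergraph.rightCongruence Set.univ F) (smallUniverse t) ∧
      HasInfiniteIndexOver (BdHypergraph.rightCongruence (smallUniverse t) F)
        (smallUniverse t) ∧
      (¬ ∃ A : TreeAutomaton (ParseOp t), A.Recognizes (parseTrees F)) ∧
      (¬ ∃ A : TreeAutomaton (ParseOp t), A.Decides F) := by
  choose T G hG hN using fun (s : Bool) (n : ℕ) => constructible_side (t := t) ht s n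
  have hwc : ∀ s n, (G s n).WellColored := fun s n =>
    (hN s n).wellColored fun _ _ h => h.color_ne
  -- All names except `base` record their side.
  have hS : ∀ a b : ℕ, (SyncName.side false a ∩ SyncName.side true b : Set (SyncName t)) ⊆
      Set.range SyncName.base := by
    rintro a b x ⟨h1, h2⟩
    rcases x with i | _ | _ | _ | _
    · exact ⟨i, rfl⟩
    all_goals
      first
        | exact absurd (h1.1.symm.trans h2.1) Bool.false_ne_true
        | exact absurd (Eq.trans (Eq.symm h1) h2) Bool.false_ne_true
  have hcomp : ∀ a b, BdGraph.Compatible (G false a) (G true b) := fun a b =>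
    (hN false a).compatible (hN true b)
  have hglue : ∀ a b, (G false a).toHypergraph.glue (G true b).toHypergraph ∈ F ↔ a = b :=
    fun a b => hF _ (fun s => if s then b else a)
      ((hN false a).glue_toHypergraph_isDescribed (hN true b) (hS a b))
  have hglue' : ∀ a b, ((G false a).glue (G true b) (hcomp a b)).toHypergraph ∈ F ↔ a = b :=
    fun a b => hF _ (fun s => if s then b else a)
      ((hN false a).glue (hN true b) (hS a b) (hcomp a b)).toHypergraph_isDescribed
  have hsmall : ∀ s n, (G s n).toHypergraph ∈ smallUniverse t := fun s n =>
    ⟨T s n, G s n, hG s n, hwc s n, rfl⟩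
  have hindex : ∀ U : Set (BdHypergraph t), smallUniverse t ⊆ U →
      HasInfiniteIndexOver (BdHypergraph.rightCongruence U F) (smallUniverse t) := by
    intro U hU
    refine Set.infinite_of_injective_forall_mem
      (f := fun a => Quotient.mk _ (G false a).toHypergraph) (fun a b hab => ?_)
      (fun a => ⟨_, hsmall false a, rfl⟩)
    -- The right side with parameter `a` distinguishes the left sides `a` and `b`. It lies in the
    -- small universe, so every larger class of tests works too.
    have h := (Quotient.exact hab).2 (G true a).toHypergraph (hU (hsmall true a))
      (hcomp a a).gluable (hcomp b a).gluable
    rw [hglue, hglue] at h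
    exact (h.1 rfl).symm
  have hdec : ¬ ∃ A : TreeAutomaton (ParseOp t), A.Decides F := by
    rintro ⟨A, hA⟩
    have := A.finite_state
    -- Two left sides reach the same state, so the automaton cannot tell them apart after gluing the
    -- right side `a` to each.
    obtain ⟨a, b, hab, hrun⟩ := Finite.exists_ne_map_eq_of_infinite fun a => A.run (T false a)
    have hacc : ∀ c, A.Accepts (.binary .glue (T false c) (T true a)) ↔ c = a := fun c =>
      (hA _ _ (Generates.glue (hcomp c a) (hG false c) (hG true a))
        (((hN false c).glue (hN true a) (hS c a) (hcomp c a)).wellColored (by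
          rintro x y (⟨-, -, h⟩ | ⟨-, -, h⟩) <;> exact h.color_ne))).trans (hglue' c a)
    have hb := hacc b
    rw [TreeAutomaton.Accepts, TreeAutomaton.run, ← hrun] at hb
    exact hab (hb.1 ((hacc a).2 rfl)).symm
  exact ⟨hindex _ (Set.subset_univ _), hindex _ le_rfl,
    fun ⟨A, hA⟩ => hdec ⟨A, hA.decides⟩, hdec⟩

theorem mainTheorem5 (t : ℕ) [NeZero t] (ht : 41 ≤ t) :
    (HasInfiniteIndexOver (BdHypergraph.rightCongruence Set.univ (KHTW t 4)) (smallUniverse t) ∧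
      HasInfiniteIndexOver (BdHypergraph.rightCongruence (smallUniverse t) (KHTW t 4))
        (smallUniverse t) ∧
      (¬ ∃ A : TreeAutomaton (ParseOp t), A.Recognizes (parseTrees (KHTW t 4))) ∧
      (¬ ∃ A : TreeAutomaton (ParseOp t), A.Decides (KHTW t 4))) ∧
    (HasInfiniteIndexOver (BdHypergraph.rightCongruence Set.univ (KFHTW t 4)) (smallUniverse t) ∧
      HasInfiniteIndexOver (BdHypergraph.rightCongruence (smallUniverse t) (KFHTW t 4))
        (smallUniverse t) ∧
      (¬ ∃ A : TreeAutomaton (ParseOp t), A.Recognizes (parseTrees (KFHTW t 4))) ∧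
      (¬ ∃ A : TreeAutomaton (ParseOp t), A.Decides (KFHTW t 4))) := by
  -- Fifteen permanent labels and three rolling ones suffice.
  have ht' : 18 ≤ t := by omega
  refine ⟨infinite_index_of_described ht' _ fun H n hH => (hypertreeWidthLE_iff ht' hH).1,
    infinite_index_of_described ht' _ fun H n hH => ?_⟩
  have := (hypertreeWidthLE_iff ht' hH).2
  change H.toFinHypergraph.FractionalHypertreeWidthLE ((4 : ℕ) : ℝ) ↔ _
  exact_mod_cast this
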